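/- Let $N\ge 3$, let $\Omega\subset\mathbb R^N$ be open and bounded, let $T>0$ and $\Omega_T=(0,T)\times\Omega$. Let $M$ be a measurable $N\times N$ matrix field on $\Omega_T$ such that, for constants $0<\alpha\le\beta$ and almost every $(t,x)\in\Omega_T$, $\alpha|\xi|^2\le M(t,x)\xi\cdot\xi$ for all $\xi\in\mathbb R^N$ and $|M(t,x)|\le\beta$. Let $\theta>0$, $f,g\in L^1(\Omega_T)$ and $E\in (L^2(\Omega_T))^N$. Denote by $W^2(0,T)$ the space of all $u\in L^2(0,T;W^{1,2}_0(\Omega))$ with $\partial_t u\in L^2(0,T;W^{-1,2}(\Omega))$, by $W^2_{loc}(0,T)$ its local counterpart (the same with $L^2_{loc}$ in place of $L^2$, i.e. $L^2$ on every $[t_1,t_2]\subset(0,T)$), and by $\langle\cdot,\cdot\rangle$ the duality pairing between $W^{-1,2}(\Omega)$ and $W^{1,2}_0(\Omega)$. Let $v,w\in C([0,T];L^1(\Omega))\cap W^2_{loc}(0,T)$ be such that $|E|(|v|^{\theta+1}+|w|^{\theta+1})\in L^2_{loc}((0,T);L^2(\Omega))$ and $|E|(|v|^{\theta}+|w|^{\theta})\in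 L^2(\Omega_T)$. Assume that $v$ is a weak subsolution with source $f$ and $w$ is a weak supersolution with source $g$, that is, for all $0<t_1<t_2<T$ and all $\varphi\in W^2(0,T)\cap L^\infty(\Omega_T)$ with $\varphi\ge0$, $$\int_{t_1}^{t_2}\langle\partial_t v,\varphi\rangle\,dt+\int_{t_1}^{t_2}\!\int_\Omega\big(M\nabla v+E|v|^\theta v\big)\cdot\nabla\varphi\,dx\,dt\le\int_{t_1}^{t_2}\!\int_\Omega f\varphi\,dx\,dt,$$ $$\int_{t_1}^{t_2}\langle\partial_t w,\varphi\rangle\,dt+\int_{t_1}^{t_2}\!\int_\Omega\big(M\nabla w+E|w|^\theta w\big)\cdot\nabla\varphi\,dx\,dt\ge\int_{t_1}^{t_2}\!\int_\Omega g\varphi\,dx\,dt.$$ Then for every $\tau\in[0,T]$ $$\int_\Omega (v(\tau)-w(\tau))_+\,dx\le\int_0^\tau\!\int_\Omega (f-g)\,\chi_{\{v>w\}}\,dx\,dt+\int_\Omega (v(0)-w(0))_+\,dx.$$ In particular, if in addition $v$ is also a weak supersolution with source $f$ and $w$ is also a weak subsolution with source $g$ (so that both are weak solutions), and if $f=g$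 a.e. in $\Omega_T$ and $v(0)=w(0)$, then $v(\tau)=w(\tau)$ for every $\tau\in[0,T]$. -/

import Mathlib

open MeasureTheory Set
open scoped ContDiff InnerProductSpace ENNReal

noncomputable section

namespace DriftParabolic

/-- The Euclidean space `ℝ^N`. -/
abbrev Eu (N : ℕ) : Type := EuclideanSpace ℝ (Fin N)

/-- The space-time cylinder `Ω_T = (0,T) × Ω`. -/
def spaceTime {N : ℕ} (Ω : Set (Eu N)) (T : ℝ) : Set (ℝ × Eu N) := Ioo 0 T ×ˢ Ω

/-- The Hilbert space `L²(Ω) × L²(Ω; ℝ^N)`, with norm `(‖u‖² + ‖F‖²)^{1/2}`. -/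
abbrev L2Pair {N : ℕ} (Ω : Set (Eu N)) : Type :=
  WithLp 2 (Lp ℝ 2 (volume.restrict Ω) × Lp (Eu N) 2 (volume.restrict Ω))

/-- Smooth functions with compact support in `Ω`, i.e. `C_c^∞(Ω)`. -/
def IsTestFunction {N : ℕ} (Ω : Set (Eu N)) (η : Eu N → ℝ) : Prop :=
  ContDiff ℝ ∞ η ∧ HasCompactSupport η ∧ tsupport η ⊆ Ω

/-- The subspace `{(η, ∇η) : η ∈ C_c^∞(Ω)}` of `L²(Ω) × L²(Ω; ℝ^N)`. -/
def testGraph {N : ℕ} (Ω : Set (Eu N)) : Submodule ℝ (L2Pair Ω) where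
  carrier := {p | ∃ η : Eu N → ℝ, IsTestFunction Ω η ∧
    (∀ᵐ x ∂(volume.restrict Ω), p.fst x = η x) ∧
    (∀ᵐ x ∂(volume.restrict Ω), p.snd x = gradient η x)}
  zero_mem' := by
    refine ⟨fun _ => 0, ⟨contDiff_const, HasCompactSupport.zero, ?_⟩, ?_, ?_⟩
    · have h : tsupport (fun _ : Eu N => (0 : ℝ)) = ∅ := tsupport_eq_empty_iff.2 rfl
      rw [h]; exact empty_subset _
    · filter_upwards [Lp.coeFn_zero ℝ 2 (volume.restrict Ω)] with x hx
      simpa using hx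
    · filter_upwards [Lp.coeFn_zero (Eu N) 2 (volume.restrict Ω)] with x hx
      simpa [gradient] using hx
  add_mem' := by
    rintro p q ⟨η, ⟨h1, h2, h3⟩, h4, h5⟩ ⟨ζ, ⟨k1, k2, k3⟩, k4, k5⟩
    refine ⟨η + ζ, ⟨h1.add k1, h2.add k2, ?_⟩, ?_, ?_⟩
    · exact (tsupport_add η ζ).trans (union_subset h3 k3)
    · filter_upwards [h4, k4, Lp.coeFn_add p.fst q.fst] with x a b c
      simpa [a, b] using c
    · filter_upwards [h5, k5, Lp.coeFn_add p.snd q.snd] with x a b c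
      have e : gradient (η + ζ) x = gradient η x + gradient ζ x := by
        rw [gradient, fderiv_add (h1.differentiable (by simp) x)
          (k1.differentiable (by simp) x), map_add]
        rfl
      simpa [a, b, e] using c
  smul_mem' := by
    rintro r p ⟨η, ⟨h1, h2, h3⟩, h4, h5⟩
    refine ⟨r • η, ⟨h1.const_smul r, h2.smul_left (f := fun _ => r), ?_⟩, ?_, ?_⟩
    · exact (closure_mono (Function.support_const_smul_subset r η)).trans h3
    · filter_upwards [h4, Lp.coeFn_smul r p.fst] with x a c
      simpa [a] using c
    · filter_upwards [h5, Lp.coeFn_smul r p.snd] with x a c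
      have e : gradient (r • η) x = r • gradient η x := by
        rw [gradient, fderiv_const_smul (h1.differentiable (by simp) x), map_smul]
        rfl
      simpa [a, e] using c

/-- The Sobolev space `W^{1,2}_0(Ω)`: the closure of `C_c^∞(Ω)` in the norm
`(‖u‖²_{L²} + ‖∇u‖²_{L²})^{1/2}`. An element is stored together with its weak gradient, as the
pair `(u, ∇u)`. -/
abbrev W0 {N : ℕ} (Ω : Set (Eu N)) : Type := (testGraph Ω).topologicalClosure

/-- The underlying `L²(Ω)` function of an element of `W^{1,2}_0(Ω)`. -/
def W0.fn {N : ℕ} {Ω : Set (Eu N)} (u : W0 Ω) : Lp ℝ 2 (volume.restrict Ω) :=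
  (u : L2Pair Ω).fst

/-- The weak gradient of an element of `W^{1,2}_0(Ω)`. -/
def W0.grad {N : ℕ} {Ω : Set (Eu N)} (u : W0 Ω) : Lp (Eu N) 2 (volume.restrict Ω) :=
  (u : L2Pair Ω).snd

/-- The space `W^{-1,2}(Ω)`, the dual of `W^{1,2}_0(Ω)`; the duality pairing is application. -/
abbrev WNeg {N : ℕ} (Ω : Set (Eu N)) : Type := StrongDual ℝ (W0 Ω)

/-- `u ∈ L²(a,b;X)` (Bochner). -/
def MemL2 {X : Type*} [NormedAddCommGroup X] (a b : ℝ) (u : ℝ → X) : Prop :=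
  MemLp u 2 (volume.restrict (Ioo a b))

/-- `u ∈ L²_loc(0,T;X)`: `u ∈ L²(a,b;X)` whenever `[a,b] ⊂ (0,T)`. -/
def MemL2loc {X : Type*} [NormedAddCommGroup X] (T : ℝ) (u : ℝ → X) : Prop :=
  ∀ a b : ℝ, 0 < a → a < b → b < T → MemL2 a b u

/-- `u' = ∂_t u` on `(0,T)` in the sense of `W^{-1,2}(Ω)`-valued distributions, where
`W^{1,2}_0(Ω) ⊂ L²(Ω) ⊂ W^{-1,2}(Ω)` through the inner product of `L²(Ω)`. -/
def HasWeakTimeDeriv {N : ℕ} {Ω : Set (Eu N)} (T : ℝ) (u : ℝ → W0 Ω) (u' : ℝ → WNeg Ω) : Prop :=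
  ∀ (ζ : W0 Ω) (ψ : ℝ → ℝ), ContDiff ℝ ∞ ψ → HasCompactSupport ψ → tsupport ψ ⊆ Ioo 0 T →
    ∫ t in Ioo 0 T, deriv ψ t * ⟪(u t).fn, ζ.fn⟫_ℝ = -∫ t in Ioo 0 T, ψ t * u' t ζ

/-- `u ∈ W²(0,T)`. -/
def MemW2 {N : ℕ} {Ω : Set (Eu N)} (T : ℝ) (u : ℝ → W0 Ω) : Prop :=
  MemL2 0 T u ∧ ∃ u' : ℝ → WNeg Ω, MemL2 0 T u' ∧ HasWeakTimeDeriv T u u'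

/-- `u ∈ L^∞(Ω_T)`. -/
def MemLInfty {N : ℕ} {Ω : Set (Eu N)} (T : ℝ) (u : ℝ → W0 Ω) : Prop :=
  ∃ C : ℝ, ∀ᵐ t ∂(volume.restrict (Ioo 0 T)), ∀ᵐ x ∂(volume.restrict Ω), |(u t).fn x| ≤ C

/-- `u ≥ 0` almost everywhere in `Ω_T`. -/
def IsNonneg {N : ℕ} {Ω : Set (Eu N)} (T : ℝ) (u : ℝ → W0 Ω) : Prop :=
  ∀ᵐ t ∂(volume.restrict (Ioo 0 T)), ∀ᵐ x ∂(volume.restrict Ω), 0 ≤ (u t).fn x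

/-- `v ∈ C([0,T];L¹(Ω)) ∩ W²_loc(0,T)`. Here `V` is `v` regarded as a function with values in
`W^{1,2}_0(Ω)`, and `V'` is its time derivative; both are determined by `v` up to null sets of
times. -/
structure MemCL1W2loc {N : ℕ} {Ω : Set (Eu N)} (T : ℝ) (v : ℝ → Lp ℝ 1 (volume.restrict Ω))
    (V : ℝ → W0 Ω) (V' : ℝ → WNeg Ω) : Prop where
  continuousOn : ContinuousOn v (Icc 0 T)
  ae_eq : ∀ᵐ t ∂(volume.restrict (Ioo 0 T)), ∀ᵐ x ∂(volume.restrict Ω), (V t).fn x = v t x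
  memL2loc : MemL2loc T V
  memL2loc_deriv : MemL2loc T V'
  hasWeakTimeDeriv : HasWeakTimeDeriv T V V'

/-- Finiteness of the norm of `F` in `L²((a,b);L²(Ω)) = L²((a,b) × Ω)`. It is only used for `F`
built from measurable functions on `Ω_T` and from elements of `C([0,T];L¹(Ω))`, for which the
inner integral is a measurable function of `t`. -/
def FiniteL2 {N : ℕ} (Ω : Set (Eu N)) (a b : ℝ) (F : ℝ → Eu N → ℝ) : Prop :=
  ∫⁻ t in Ioo a b, ∫⁻ x in Ω, ‖F t x‖ₑ ^ 2 < ⊤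

/-- The left-hand side of the weak formulation,
`∫_{t₁}^{t₂} ⟨∂_t v, φ⟩ + ∫_{t₁}^{t₂} ∫_Ω (M ∇v · ∇φ + E |v|^θ v · ∇φ)`. -/
def weakForm {N : ℕ} {Ω : Set (Eu N)} (M : ℝ × Eu N → (Eu N →L[ℝ] Eu N)) (E : ℝ × Eu N → Eu N)
    (θ : ℝ) (v : ℝ → Lp ℝ 1 (volume.restrict Ω)) (V : ℝ → W0 Ω) (V' : ℝ → WNeg Ω)
    (φ : ℝ → W0 Ω) (t₁ t₂ : ℝ) : ℝ :=
  (∫ t in t₁..t₂, V' t (φ t)) +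
    ∫ t in t₁..t₂, ∫ x in Ω, (⟪M (t, x) ((V t).grad x), (φ t).grad x⟫_ℝ
      + ⟪(|v t x| ^ θ * v t x) • E (t, x), (φ t).grad x⟫_ℝ)

/-- `v` is a weak subsolution of `∂_t v - div(M ∇v + E |v|^θ v) = f` in `Ω_T`, `v = 0` on
`(0,T) × ∂Ω`. -/
def IsSubsolution {N : ℕ} {Ω : Set (Eu N)} (T : ℝ) (M : ℝ × Eu N → (Eu N →L[ℝ] Eu N))
    (E : ℝ × Eu N → Eu N) (θ : ℝ) (f : ℝ × Eu N → ℝ) (v : ℝ → Lp ℝ 1 (volume.restrict Ω))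
    (V : ℝ → W0 Ω) (V' : ℝ → WNeg Ω) : Prop :=
  ∀ t₁ t₂ : ℝ, 0 < t₁ → t₁ < t₂ → t₂ < T →
    ∀ φ : ℝ → W0 Ω, MemW2 T φ → MemLInfty T φ → IsNonneg T φ →
      weakForm M E θ v V V' φ t₁ t₂ ≤ ∫ t in t₁..t₂, ∫ x in Ω, f (t, x) * (φ t).fn x

/-- `w` is a weak supersolution of the same problem. -/
def IsSupersolution {N : ℕ} {Ω : Set (Eu N)} (T : ℝ) (M : ℝ × Eu N → (Eu N →L[ℝ] Eu N))
    (E : ℝ × Eu N → Eu N) (θ : ℝ) (g : ℝ × Eu N → ℝ) (w : ℝ → Lp ℝ 1 (volume.restrict Ω))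
    (W : ℝ → W0 Ω) (W' : ℝ → WNeg Ω) : Prop :=
  ∀ t₁ t₂ : ℝ, 0 < t₁ → t₁ < t₂ → t₂ < T →
    ∀ φ : ℝ → W0 Ω, MemW2 T φ → MemLInfty T φ → IsNonneg T φ →
      ∫ t in t₁..t₂, ∫ x in Ω, g (t, x) * (φ t).fn x ≤ weakForm M E θ w W W' φ t₁ t₂

end DriftParabolic

end

open DriftParabolic

/-! ### Weak derivatives on an interval -/

section ContractionLemmas

open Filter Topology

/-! Put z = v - w and test the difference of the two inequalities with H(z), where H is a smooth
nondecreasing approximation of the Heaviside function at scale ε and Θ is its primitive. The time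
term dominates the increment of ∫ Θ(z), which tends to that of ∫ z₊, and the source term tends to
the integral of f - g over {v > w}. In the flux term the map s ↦ |s|^θ s is locally Lipschitz, so
Young's inequality absorbs ∇z into the ellipticity and leaves a multiple of H'(z) z² (|E| (|v|^θ +
|w|^θ))² (`neg_le_inner_flux`). Since H' ≤ L/ε and H' vanishes off [0, ε], one has H'(z) z² ≤ Lε,
and the global L² hypothesis makes this remainder O(ε). Letting ε → 0 gives the estimate between
interior times (`integral_posPart_sub_le`), and continuity in L¹ carries it to the times 0 and τ.
Uniqueness follows by exchanging the two solutions.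

The difficulty is that H(z) is not known to be an admissible test function: it is only controlled
locally in time, and no W^{-1,2} bound on its time derivative is available. Hence the inequalities
are tested only with functions ζ constant in time with values in [0,1]. By separability they hold,
off a single null set of times, for all such ζ at once (`ae_forall_unitBounded_le`), and ζ = H(z(t))
is inserted afterwards.

The chain rule in time is needed in one direction only (`integral_comp_sub_le_integral_pairing`).
Convexity gives Θ(z(t)) - Θ(z(t-h)) ≤ H(z(t)) (z(t) - z(t-h)); paired with H(z(t)), the increment of
z is the integral of its weak derivative over (t-h, t); averaging in t and letting h → 0 uses only
the continuity of translations in L². -/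

theorem exists_Icc_of_isCompact_subset_Ioo {a b c : ℝ} {K : Set ℝ} (hK : IsCompact K)
    (hKs : K ⊆ Ioo a b) (hc : c ∈ Ioo a b) :
    ∃ p q : ℝ, a < p ∧ p < c ∧ c < q ∧ q < b ∧ K ⊆ Ioo p q := by
  have hK' : IsCompact (insert c K) := hK.insert c
  have hne : (insert c K).Nonempty := ⟨c, mem_insert _ _⟩
  have hs : insert c K ⊆ Ioo a b := insert_subset hc hKs
  obtain ⟨p, hp, hp'⟩ := hK'.exists_isLeast hne
  obtain ⟨q, hq, hq'⟩ := hK'.exists_isGreatest hne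
  refine ⟨(a + p) / 2, (q + b) / 2, by linarith [(hs hp).1], ?_, ?_, by linarith [(hs hq).2], ?_⟩
  · linarith [(hs hp).1, hp' (mem_insert c K)]
  · linarith [(hs hq).2, hq' (mem_insert c K)]
  · intro x hx
    have h1 := hp' (mem_insert_of_mem c hx)
    have h2 := hq' (mem_insert_of_mem c hx)
    exact ⟨by linarith [(hs hp).1], by linarith [(hs hq).2]⟩

/-- The du Bois-Reymond lemma: a function with vanishing weak derivative is constant. -/
theorem exists_ae_eq_const_of_integral_deriv_mul_eq_zero {g : ℝ → ℝ} {a b : ℝ} (hab : a < b)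
    (hg : LocallyIntegrableOn g (Ioo a b))
    (h : ∀ ψ : ℝ → ℝ, ContDiff ℝ ∞ ψ → HasCompactSupport ψ → tsupport ψ ⊆ Ioo a b →
      ∫ t, deriv ψ t * g t = 0) :
    ∃ c : ℝ, ∀ᵐ t, t ∈ Ioo a b → g t = c := by
  have key : ∀ η : ℝ → ℝ, ContDiff ℝ ∞ η → HasCompactSupport η → tsupport η ⊆ Ioo a b →
      Integrable (fun t => η t * g t) := by
    intro η h1 h2 h3
    have h4 : IntegrableOn (fun t => η t * g t) (tsupport η) :=
      (hg.integrableOn_compact_subset h3 h2).continuousOn_mul h1.continuous.continuousOn h2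
    rw [← integrableOn_iff_integrable_of_support_subset (s := tsupport η)]
    · exact h4
    · intro t ht
      apply subset_tsupport
      intro h0
      apply ht
      simp [h0]
  -- The outer radius (b - a)/4 keeps the support inside (a, b); normalization gives χ integral one.
  let χb : ContDiffBump ((a + b) / 2) := ⟨(b - a) / 8, (b - a) / 4, by linarith, by linarith⟩
  let χ : ℝ → ℝ := χb.normed volume
  have hχ1 : ContDiff ℝ ∞ χ := χb.contDiff_normed
  have hχ2 : HasCompactSupport χ := χb.hasCompactSupport_normed
  have hχ3 : tsupport χ ⊆ Ioo a b := by
    rw [χb.tsupport_normed_eq, Real.closedBall_eq_Icc]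
    intro x hx
    simp only [χb, mem_Icc] at hx
    exact ⟨by linarith [hx.1], by linarith [hx.2]⟩
  have hχ4 : ∫ t, χ t = 1 := χb.integral_normed
  refine ⟨∫ t, χ t * g t, ?_⟩
  set c := ∫ t, χ t * g t with hc
  have := isOpen_Ioo.ae_eq_zero_of_integral_contDiff_smul_eq_zero (f := fun t => g t - c)
    (U := Ioo a b) (μ := volume) (hg.sub ((locallyIntegrable_const c).locallyIntegrableOn _)) ?_
  · filter_upwards [this] with t ht htt
    linarith [ht htt]
  intro η h1 h2 h3
  set I := ∫ t, η t with hI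
  -- Removing the mean of η makes the primitive of ρ compactly supported in (a, b), hence an
  -- admissible ψ.
  let ρ : ℝ → ℝ := fun t => η t - I * χ t
  have hηi : Integrable η := h1.continuous.integrable_of_hasCompactSupport h2
  have hχi : Integrable χ := hχ1.continuous.integrable_of_hasCompactSupport hχ2
  have hρ : ContDiff ℝ ∞ ρ := h1.sub (contDiff_const.mul hχ1)
  have hρi : Integrable ρ := hηi.sub (hχi.const_mul I)
  have hρ0 : ∫ t, ρ t = 0 := by
    simp only [ρ]
    rw [integral_sub hηi (hχi.const_mul I), integral_const_mul, hχ4]; ring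
  let ψ : ℝ → ℝ := fun t => ∫ s in a..t, ρ s
  have hψd : ∀ t, HasDerivAt ψ (ρ t) t := fun t =>
    intervalIntegral.integral_hasDerivAt_right (hρ.continuous.intervalIntegrable _ _)
      hρ.continuous.stronglyMeasurable.stronglyMeasurableAtFilter hρ.continuous.continuousAt
  have hψ' : deriv ψ = ρ := funext fun t => (hψd t).deriv
  have hψ1 : ContDiff ℝ ∞ ψ :=
    contDiff_infty_iff_deriv.2 ⟨fun t => (hψd t).differentiableAt, hψ' ▸ hρ⟩
  obtain ⟨p, q, hp, -, -, hq, hpq⟩ := exists_Icc_of_isCompact_subset_Ioo (c := (a + b) / 2)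
    (h2.isCompact.union hχ2.isCompact) (union_subset h3 hχ3)
    ⟨by linarith, by linarith⟩
  have hρout : ∀ t, t ∉ Ioo p q → ρ t = 0 := by
    intro t ht
    have e1 : η t = 0 := by
      by_contra h0; exact ht (hpq (Or.inl (subset_tsupport _ h0)))
    have e2 : χ t = 0 := by
      by_contra h0; exact ht (hpq (Or.inr (subset_tsupport _ h0)))
    simp [ρ, e1, e2]
  have hψout : ∀ t, t ∉ Icc p q → ψ t = 0 := by
    intro t ht
    rcases lt_or_ge t p with htp | htp
    · apply intervalIntegral.integral_zero_ae
      refine Eventually.of_forall fun s hs => hρout s fun hs' => ?_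
      rw [mem_uIoc] at hs
      rcases hs with hs | hs <;> linarith [hs'.1, hs.2]
    · have htq : q < t := by
        by_contra hh; exact ht ⟨htp, not_lt.1 hh⟩
      have : ∫ s in a..t, ρ s = ∫ s, ρ s := by
        apply intervalIntegral.integral_eq_integral_of_support_subset
        intro s hs
        have : s ∈ Ioo p q := by
          by_contra h0; exact hs (hρout s h0)
        exact ⟨by linarith [this.1], by linarith [this.2]⟩
      simp only [ψ]
      rw [this, hρ0]
  have hts : tsupport ψ ⊆ Icc p q := by
    refine closure_minimal (fun t ht => ?_) isClosed_Icc
    by_contra h0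
    exact ht (hψout t h0)
  have hh := h ψ hψ1 (HasCompactSupport.of_support_subset_isCompact isCompact_Icc
    ((subset_tsupport ψ).trans hts))
    (hts.trans fun t ht => ⟨by linarith [ht.1], by linarith [ht.2]⟩)
  rw [hψ'] at hh
  have e1 : (fun t => ρ t * g t) = fun t => η t * g t - I * (χ t * g t) := by
    funext t; simp only [ρ]; ring
  rw [e1, integral_sub (key η h1 h2 h3) ((key χ hχ1 hχ2 hχ3).const_mul I),
    integral_const_mul, ← hc] at hh
  have e2 : (fun t => η t • (g t - c)) = fun t => η t * g t - η t * c := by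
    funext t; simp only [smul_eq_mul]; ring
  rw [e2, integral_sub (key η h1 h2 h3) (hηi.mul_const c), integral_mul_const]
  exact hh

/-- A locally integrable function with a locally integrable weak derivative is a primitive of it. -/
theorem exists_ae_eq_const_add_integral {g k : ℝ → ℝ} {a b m : ℝ} (hm : m ∈ Ioo a b)
    (hg : LocallyIntegrableOn g (Ioo a b)) (hk : LocallyIntegrableOn k (Ioo a b))
    (h : ∀ ψ : ℝ → ℝ, ContDiff ℝ ∞ ψ → HasCompactSupport ψ → tsupport ψ ⊆ Ioo a b →
      ∫ t in Ioo a b, deriv ψ t * g t = -∫ t in Ioo a b, ψ t * k t) :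
    ∃ c : ℝ, ∀ᵐ t, t ∈ Ioo a b → g t = c + ∫ s in m..t, k s := by
  have hki : ∀ p q, a < p → q < b → p ≤ q → IntervalIntegrable k volume p q := by
    intro p q hp hq hpq
    rw [intervalIntegrable_iff_integrableOn_Icc_of_le hpq]
    exact hk.integrableOn_compact_subset (fun t ht => ⟨by linarith [ht.1], by linarith [ht.2]⟩)
      isCompact_Icc
  let K : ℝ → ℝ := fun t => ∫ s in m..t, k s
  have hKac : ∀ p q, a < p → p < m → m < q → q < b → AbsolutelyContinuousOnInterval K p q :=
    fun p q h1 h2 h3 h4 =>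
      (hki p q h1 h4 (h2.trans h3).le).absolutelyContinuousOnInterval_intervalIntegral
        (by rw [uIcc_of_le (h2.trans h3).le]; exact ⟨h2.le, h3.le⟩)
  have hKc : ContinuousOn K (Ioo a b) := by
    intro t ht
    obtain ⟨p, q, h1, h2, h3, h4, h5⟩ := exists_Icc_of_isCompact_subset_Ioo (K := {t})
      isCompact_singleton (by simpa using ht) hm
    have h6 := (hKac p q h1 h2 h3 h4).continuousOn
    rw [uIcc_of_le (h2.trans h3).le] at h6
    exact (h6.continuousAt (Icc_mem_nhds (h5 rfl).1 (h5 rfl).2)).continuousWithinAt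
  have hKl : LocallyIntegrableOn K (Ioo a b) := hKc.locallyIntegrableOn measurableSet_Ioo
  have hIoo : ∀ φ : ℝ → ℝ, (∀ t, t ∉ Ioo a b → φ t = 0) → ∫ t in Ioo a b, φ t = ∫ t, φ t :=
    fun φ hφ => setIntegral_eq_integral_of_forall_compl_eq_zero fun t ht => hφ t ht
  -- g - K has zero weak derivative: K is absolutely continuous on compact subintervals, so it may
  -- be integrated by parts against ψ, which vanishes at the ends.
  obtain ⟨c, hc⟩ := exists_ae_eq_const_of_integral_deriv_mul_eq_zero (g := fun t => g t - K t)
    (hm.1.trans hm.2) (hg.sub hKl) (fun ψ h1 h2 h3 => by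
      have hd2 : HasCompactSupport (deriv ψ) := h2.deriv
      have hd3 : tsupport (deriv ψ) ⊆ Ioo a b := (tsupport_deriv_subset).trans h3
      have hd1 : ContDiff ℝ ∞ (deriv ψ) := (contDiff_infty_iff_deriv.1 h1).2
      have h0 : ∀ t, t ∉ tsupport ψ → ψ t = 0 := fun t ht => image_eq_zero_of_notMem_tsupport ht
      have hd0 : ∀ t, t ∉ tsupport ψ → deriv ψ t = 0 := fun t ht =>
        image_eq_zero_of_notMem_tsupport fun hh => ht (tsupport_deriv_subset hh)
      have key : ∀ g : ℝ → ℝ, LocallyIntegrableOn g (Ioo a b) →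
          Integrable (fun t => deriv ψ t * g t) := by
        intro g hg
        rw [← integrableOn_iff_integrable_of_support_subset (s := tsupport ψ)]
        · exact (hg.integrableOn_compact_subset h3 h2).continuousOn_mul
            hd1.continuous.continuousOn h2
        · intro t ht
          by_contra hh
          apply ht
          simp [hd0 t hh]
      have e1 : (fun t => deriv ψ t * (g t - K t)) = fun t => deriv ψ t * g t - deriv ψ t * K t := by
        funext t; ring
      rw [e1, integral_sub (key g hg) (key K hKl)]
      have e2 := h ψ h1 h2 h3
      rw [hIoo _ (fun t ht => by rw [hd0 t fun hh => ht (h3 hh), zero_mul]),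
        hIoo _ (fun t ht => by rw [h0 t fun hh => ht (h3 hh), zero_mul])] at e2
      rw [e2]
      obtain ⟨p, q, hp, hpm, hmq, hq, hpq⟩ := exists_Icc_of_isCompact_subset_Ioo h2.isCompact h3 hm
      have hpq' : p ≤ q := (hpm.trans hmq).le
      have hint : ∀ φ : ℝ → ℝ, (∀ t, t ∉ tsupport ψ → φ t = 0) →
          ∫ t, φ t = ∫ t in p..q, φ t := fun φ hφ =>
        (intervalIntegral.integral_eq_integral_of_support_subset fun s hs => by
          have : s ∈ tsupport ψ := by
            by_contra hh; exact hs (hφ s hh)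
          exact Ioo_subset_Ioc_self (hpq this)).symm
      have hψac : AbsolutelyContinuousOnInterval ψ p q :=
        ContDiffOn.absolutelyContinuousOnInterval (h1.of_le (by simp)).contDiffOn
      have ibp := hψac.integral_mul_deriv_eq_deriv_mul (hKac p q hp hpm hmq hq)
      have hψp : ψ p = 0 := h0 p fun hh => lt_irrefl _ (hpq hh).1
      have hψq : ψ q = 0 := h0 q fun hh => lt_irrefl _ (hpq hh).2
      have e3 : ∫ t in p..q, ψ t * deriv K t = ∫ t in p..q, ψ t * k t := by
        apply intervalIntegral.integral_congr_ae
        filter_upwards [(hki p q hp hq hpq').ae_hasDerivAt_integral] with t ht htt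
        rw [(ht (uIoc_subset_uIcc htt) m
          (by rw [uIcc_of_le hpq']; exact ⟨hpm.le, hmq.le⟩)).deriv]
      rw [hint _ (fun t ht => by rw [h0 t ht, zero_mul]),
        hint _ (fun t ht => by rw [hd0 t ht, zero_mul]), ← e3, ibp, hψp, hψq]
      ring)
  refine ⟨c, ?_⟩
  filter_upwards [hc] with t ht htt
  have := ht htt
  simp only [K] at this
  linarith

/-! ### Translations in time inside a duality pairing -/

section Translation

variable {X : Type*} [NormedAddCommGroup X] [NormedSpace ℝ X]
  {U : ℝ → StrongDual ℝ X} {φ : ℝ → X}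

theorem MeasureTheory.MemLp.integrable_pairing {α : Type*} {m : MeasurableSpace α} {μ : Measure α}
    {U : α → StrongDual ℝ X} {φ : α → X}
    (hU : MemLp U 2 μ) (hφ : MemLp φ 2 μ) : Integrable (fun t => U t (φ t)) μ := by
  rw [← memLp_one_iff_integrable]
  refine MemLp.of_bilin (p := 2) (q := 2) (fun (L : StrongDual ℝ X) x => L x) 1 hU hφ ?_
    (Eventually.of_forall fun t => ?_)
  · exact (ContinuousLinearMap.id ℝ (StrongDual ℝ X)).aestronglyMeasurable_comp₂ hU.1 hφ.1
  · simpa using (U t).le_opNNNorm (φ t)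

/-- Translations act continuously on L², and the pairing is bilinear and bounded. At s = 0 this
recovers the pairing without shift as a limit of shifted ones. -/
theorem continuous_integral_pairing_translate (hU : MemLp U 2 volume) (hφ : MemLp φ 2 volume) :
    Continuous (fun s : ℝ => ∫ t, U (t - s) (φ t)) := by
  let g : ℝ → C(ℝ, ℝ) := fun s => ⟨fun t => t - s, by fun_prop⟩
  have hg : Continuous g :=
    ContinuousMap.continuous_of_continuous_uncurry _ (by
      show Continuous (fun p : ℝ × ℝ => p.2 - p.1)
      fun_prop)
  have hgm : ∀ s, MeasurePreserving (g s) volume volume := fun s => measurePreserving_sub_right _ s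
  have h1 : Continuous fun s => Lp.compMeasurePreserving (g s) (hgm s) (hU.toLp U) :=
    continuous_const.compMeasurePreservingLp hg hgm (by simp)
  let B : StrongDual ℝ X →L[ℝ] X →L[ℝ] ℝ := ContinuousLinearMap.id ℝ _
  have h2 : Continuous fun s =>
      B.lpPairing volume 2 2 (Lp.compMeasurePreserving (g s) (hgm s) (hU.toLp U)) (hφ.toLp φ) :=
    ((B.lpPairing volume 2 2).continuous.comp h1).clm_apply continuous_const
  convert h2 using 2 with s
  rw [ContinuousLinearMap.lpPairing_eq_integral]
  apply integral_congr_ae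
  filter_upwards [hφ.coeFn_toLp, Lp.coeFn_compMeasurePreserving (hU.toLp U) (hgm s),
    (hgm s).quasiMeasurePreserving.ae hU.coeFn_toLp] with t e1 e2 e3
  rw [e1, e2]
  simp only [Function.comp_apply, B, ContinuousLinearMap.id_apply]
  rw [e3]
  rfl

/-- This justifies exchanging the integral in time with the average over shifts. -/
theorem integrable_pairing_translate (hU : MemLp U 2 volume) (hφ : MemLp φ 2 volume) (h : ℝ) :
    Integrable (fun p : ℝ × ℝ => U (p.1 - p.2) (φ p.1))
      ((volume : Measure ℝ).prod (volume.restrict (Ioc 0 h))) := by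
  have hm : AEStronglyMeasurable (fun p : ℝ × ℝ => U (p.1 - p.2) (φ p.1))
      ((volume : Measure ℝ).prod (volume.restrict (Ioc 0 h))) := by
    have hle : ((volume : Measure ℝ).prod (volume.restrict (Ioc 0 h))) ≤
        (volume : Measure ℝ).prod volume := Measure.prod_mono le_rfl Measure.restrict_le_self
    refine AEStronglyMeasurable.mono_measure ?_ hle
    exact (ContinuousLinearMap.id ℝ (StrongDual ℝ X)).aestronglyMeasurable_comp₂
      (hU.1.comp_quasiMeasurePreserving
        (quasiMeasurePreserving_sub_of_right_invariant volume volume)) hφ.1.comp_fst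
  rw [integrable_prod_iff' hm]
  have hUs : ∀ s, MemLp (fun t => U (t - s)) 2 volume := fun s =>
    hU.comp_measurePreserving (measurePreserving_sub_right _ s)
  refine ⟨Eventually.of_forall fun s => (hUs s).integrable_pairing hφ, ?_⟩
  have hm' : AEStronglyMeasurable (fun s => ∫ t, ‖U (t - s) (φ t)‖)
      (volume.restrict (Ioc 0 h)) := hm.norm.prod_swap.integral_prod_right'
  -- By translation invariance the bound does not depend on s, so it is integrable over the bounded
  -- range of shifts.
  have hb : ∀ s, ‖∫ t, ‖U (t - s) (φ t)‖‖ ≤ (∫ t, ‖U t‖ ^ 2) + ∫ t, ‖φ t‖ ^ 2 := by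
    intro s
    rw [Real.norm_of_nonneg (integral_nonneg fun _ => norm_nonneg _)]
    have e : ∫ t, ‖U t‖ ^ 2 = ∫ t, ‖U (t - s)‖ ^ 2 := (integral_sub_right_eq_self _ s).symm
    have i1 : Integrable fun t => ‖U (t - s)‖ ^ 2 := (hUs s).integrable_norm_pow (by simp)
    have i2 : Integrable fun t => ‖φ t‖ ^ 2 := hφ.integrable_norm_pow (by simp)
    rw [e, ← integral_add i1 i2]
    refine integral_mono_of_nonneg (Eventually.of_forall fun _ => norm_nonneg _) (i1.add i2)
      (Eventually.of_forall fun t => ?_)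
    have := (U (t - s)).le_opNorm (φ t)
    simp only
    nlinarith [sq_nonneg (‖U (t - s)‖ - ‖φ t‖), sq_nonneg ‖U (t - s)‖, sq_nonneg ‖φ t‖]
  exact Integrable.of_bound hm' _ (Eventually.of_forall hb)

end Translation

/-! ### One-sided averages of continuous functions -/

section Continuity

theorem tendsto_average_right {J : ℝ → ℝ} (hJ : Continuous J) :
    Tendsto (fun h => h⁻¹ * ∫ s in (0 : ℝ)..h, J s) (𝓝[>] 0) (𝓝 (J 0)) := by
  have := (intervalIntegral.integral_hasDerivAt_right (hJ.intervalIntegrable 0 0)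
    hJ.stronglyMeasurable.stronglyMeasurableAtFilter hJ.continuousAt).tendsto_slope_zero_right
  simpa using this

theorem tendsto_average_left {G : ℝ → ℝ} {c a d : ℝ} (hca : c < a) (had : a < d)
    (hG : ContinuousOn G (Icc c d)) :
    Tendsto (fun h => h⁻¹ * ∫ s in (a - h)..a, G s) (𝓝[>] 0) (𝓝 (G a)) := by
  have hGa : ContinuousAt G a := hG.continuousAt (Icc_mem_nhds hca had)
  have hd : HasDerivAt (fun u => ∫ s in a..u, G s) (G a) a :=
    intervalIntegral.integral_hasDerivAt_right (by simp)
      ⟨Icc c d, Icc_mem_nhds hca had, hG.aestronglyMeasurable measurableSet_Icc⟩ hGa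
  have := hd.tendsto_slope_zero_left
  have h2 : Tendsto (fun h : ℝ => -h) (𝓝[>] 0) (𝓝[<] 0) := by
    simpa using tendsto_neg_nhdsGT (a := (0 : ℝ))
  refine (this.comp h2).congr fun h => ?_
  simp only [Function.comp_apply, intervalIntegral.integral_same, sub_zero, smul_eq_mul]
  rw [intervalIntegral.integral_symm, inv_neg, ← sub_eq_add_neg]
  ring

end Continuity

/-! ### Increments of functions with a weak time derivative -/

namespace DriftParabolic

variable {N : ℕ} {Ω : Set (Eu N)} {T : ℝ}

/-- The inclusion of `W^{1,2}_0(Ω)` into `L²(Ω)`. -/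
noncomputable def W0.fnL (Ω : Set (Eu N)) : W0 Ω →L[ℝ] Lp ℝ 2 (volume.restrict Ω) :=
  (WithLp.fstL 2 ℝ _ _).comp (testGraph Ω).topologicalClosure.subtypeL

/-- The weak gradient as a continuous linear map on `W^{1,2}_0(Ω)`. -/
noncomputable def W0.gradL (Ω : Set (Eu N)) : W0 Ω →L[ℝ] Lp (Eu N) 2 (volume.restrict Ω) :=
  (WithLp.sndL 2 ℝ _ _).comp (testGraph Ω).topologicalClosure.subtypeL

theorem W0.fnL_apply (u : W0 Ω) : W0.fnL Ω u = u.fn := rfl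

theorem W0.fn_sub (u v : W0 Ω) : (u - v).fn = u.fn - v.fn := map_sub (W0.fnL Ω) u v

theorem W0.grad_sub (u v : W0 Ω) : (u - v).grad = u.grad - v.grad := map_sub (W0.gradL Ω) u v

instance : SecondCountableTopology (L2Pair Ω) :=
  haveI : Fact ((2 : ℝ≥0∞) ≠ ⊤) := ⟨by simp⟩
  WithLp.secondCountableTopology 2 _ _

instance : SecondCountableTopology (W0 Ω) :=
  TopologicalSpace.Subtype.secondCountableTopology _

instance : TopologicalSpace.SeparableSpace (W0 Ω) :=
  TopologicalSpace.SecondCountableTopology.to_separableSpace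

section MemL2

variable {X Y : Type*} [NormedAddCommGroup X] {u v : ℝ → X}

theorem MemL2.integrableOn {a b : ℝ} (hu : MemL2 a b u) : IntegrableOn u (Ioo a b) :=
  MemLp.integrable (by norm_num) hu

theorem MemL2loc.clm [NormedSpace ℝ X] [NormedAddCommGroup Y] [NormedSpace ℝ Y] (L : X →L[ℝ] Y)
    (hu : MemL2loc T u) : MemL2loc T (fun t => L (u t)) :=
  fun a b h1 h2 h3 => L.comp_memLp' (hu a b h1 h2 h3)

theorem MemL2loc.apply [NormedSpace ℝ X] {u : ℝ → StrongDual ℝ X} (hu : MemL2loc T u) (x : X) :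
    MemL2loc T (fun t => u t x) :=
  hu.clm (ContinuousLinearMap.apply ℝ ℝ x)

theorem MemL2loc.sub (hu : MemL2loc T u) (hv : MemL2loc T v) :
    MemL2loc T (fun t => u t - v t) :=
  fun a b h1 h2 h3 => MemLp.sub (hu a b h1 h2 h3) (hv a b h1 h2 h3)

theorem MemL2loc.locallyIntegrableOn (hu : MemL2loc T u) : LocallyIntegrableOn u (Ioo 0 T) := by
  intro t ht
  refine ⟨Ioo (t / 2) ((t + T) / 2), mem_nhdsWithin_of_mem_nhds
    (Ioo_mem_nhds (by linarith [ht.1]) (by linarith [ht.2])), ?_⟩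
  exact (hu _ _ (by linarith [ht.1]) (by linarith [ht.1, ht.2]) (by linarith [ht.2])).integrableOn

end MemL2

theorem HasWeakTimeDeriv.sub {u v : ℝ → W0 Ω} {u' v' : ℝ → WNeg Ω} (hu : MemL2loc T u)
    (hv : MemL2loc T v) (hu' : MemL2loc T u') (hv' : MemL2loc T v')
    (h : HasWeakTimeDeriv T u u') (k : HasWeakTimeDeriv T v v') :
    HasWeakTimeDeriv T (fun t => u t - v t) (fun t => u' t - v' t) := by
  intro ζ ψ h1 h2 h3
  -- The factors u, u' are only locally square integrable on (0,T); the compact support of ψ makes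
  -- each integral finite, so that differences may be split.
  have key : ∀ (η g : ℝ → ℝ), Continuous η → tsupport η ⊆ tsupport ψ →
      MemL2loc T g → IntegrableOn (fun t => η t * g t) (Ioo 0 T) := by
    intro η g e1 e3 e4
    rw [IntegrableOn, ← integrableOn_iff_integrable_of_support_subset (s := tsupport ψ)]
    · rw [IntegrableOn, Measure.restrict_restrict (isClosed_tsupport ψ).measurableSet,
        inter_eq_left.2 h3]
      exact (e4.locallyIntegrableOn.integrableOn_compact_subset h3 h2).continuousOn_mul
        e1.continuousOn h2
    · intro t ht
      apply e3
      apply subset_tsupport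
      intro h0
      apply ht
      simp [h0]
  have hd1 : Continuous (deriv ψ) := (contDiff_infty_iff_deriv.1 h1).2.continuous
  have hd2 : tsupport (deriv ψ) ⊆ tsupport ψ := tsupport_deriv_subset
  have l1 : ∀ u : ℝ → W0 Ω, MemL2loc T u → MemL2loc T (fun t => ⟪(u t).fn, ζ.fn⟫_ℝ) := by
    intro u hu
    have := hu.clm ((innerSL ℝ ζ.fn).comp (W0.fnL Ω))
    simpa [W0.fnL_apply, real_inner_comm] using this
  have l2 : ∀ u : ℝ → WNeg Ω, MemL2loc T u → MemL2loc T (fun t => u t ζ) :=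
    fun u hu => hu.apply ζ
  have e1 : ∀ t, deriv ψ t * ⟪(u t - v t).fn, ζ.fn⟫_ℝ =
      deriv ψ t * ⟪(u t).fn, ζ.fn⟫_ℝ - deriv ψ t * ⟪(v t).fn, ζ.fn⟫_ℝ := by
    intro t; rw [W0.fn_sub, inner_sub_left]; ring
  have e2 : ∀ t, ψ t * (u' t - v' t) ζ = ψ t * u' t ζ - ψ t * v' t ζ := by
    intro t; rw [sub_apply]; ring
  simp only [e1, e2]
  rw [integral_sub (key _ _ hd1 hd2 (l1 u hu)) (key _ _ hd1 hd2 (l1 v hv)),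
    integral_sub (key _ _ h1.continuous le_rfl (l2 u' hu'))
      (key _ _ h1.continuous le_rfl (l2 v' hv')),
    h ζ ψ h1 h2 h3, k ζ ψ h1 h2 h3]
  ring

theorem MemL2loc.intervalIntegrable {X : Type*} [NormedAddCommGroup X] [NormedSpace ℝ X]
    {u : ℝ → X} (hu : MemL2loc T u) {s t : ℝ} (hs : s ∈ Ioo 0 T) (ht : t ∈ Ioo 0 T) :
    IntervalIntegrable u volume s t := by
  rw [intervalIntegrable_iff]
  refine IntegrableOn.mono_set ?_ uIoc_subset_uIcc
  exact hu.locallyIntegrableOn.integrableOn_compact_subset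
    ((ordConnected_Ioo).uIcc_subset hs ht) isCompact_uIcc

/-- Off a null set of times, the increments of `u` are integrals of its weak time derivative. -/
theorem HasWeakTimeDeriv.exists_ae_inner_sub_eq_integral (hT : 0 < T) {u : ℝ → W0 Ω}
    {u' : ℝ → WNeg Ω} (hu : MemL2loc T u) (hu' : MemL2loc T u') (h : HasWeakTimeDeriv T u u') :
    ∃ A : Set ℝ, A ⊆ Ioo 0 T ∧ (∀ᵐ t, t ∈ Ioo 0 T → t ∈ A) ∧ ∀ s ∈ A, ∀ t ∈ A, ∀ ζ : W0 Ω,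
      ⟪(u t).fn - (u s).fn, ζ.fn⟫_ℝ = ∫ r in s..t, u' r ζ := by
  have hm : T / 2 ∈ Ioo 0 T := ⟨by linarith, by linarith⟩
  have h1 : ∀ ζ : W0 Ω, ∃ c : ℝ, ∀ᵐ t, t ∈ Ioo 0 T →
      ⟪(u t).fn, ζ.fn⟫_ℝ = c + ∫ r in (T / 2)..t, u' r ζ := by
    intro ζ
    refine exists_ae_eq_const_add_integral hm ?_ ?_ (fun ψ k1 k2 k3 => h ζ ψ k1 k2 k3)
    · have := (hu.clm ((innerSL ℝ ζ.fn).comp (W0.fnL Ω))).locallyIntegrableOn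
      simpa [W0.fnL_apply, real_inner_comm] using this
    · exact (hu'.apply ζ).locallyIntegrableOn
  choose c hc using h1
  -- The exceptional null set for each ζ depends on ζ; a countable dense family leaves one null set,
  -- and both sides of the identity are continuous in ζ.
  let D := TopologicalSpace.denseSeq (W0 Ω)
  refine ⟨{t | t ∈ Ioo 0 T ∧ ∀ n, ⟪(u t).fn, (D n).fn⟫_ℝ =
    c (D n) + ∫ r in (T / 2)..t, u' r (D n)}, fun t ht => ht.1, ?_, ?_⟩
  · have : ∀ᵐ t, ∀ n, t ∈ Ioo 0 T →
      ⟪(u t).fn, (D n).fn⟫_ℝ = c (D n) + ∫ r in (T / 2)..t, u' r (D n) :=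
      ae_all_iff.2 fun n => hc (D n)
    filter_upwards [this] with t ht htt using ⟨htt, fun n => ht n htt⟩
  · rintro s ⟨hs, hs'⟩ t ⟨ht, ht'⟩ ζ
    have e : ∀ ζ : W0 Ω, ∀ s ∈ Ioo 0 T, ∀ t ∈ Ioo 0 T,
        ∫ r in s..t, u' r ζ = (∫ r in s..t, u' r) ζ := by
      intro ζ s hs t ht
      exact (ContinuousLinearMap.intervalIntegral_apply (hu'.intervalIntegrable hs ht) ζ).symm
    have c1 : Continuous fun ζ : W0 Ω => ⟪(u t).fn - (u s).fn, ζ.fn⟫_ℝ :=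
      continuous_const.inner (W0.fnL Ω).continuous
    have c2 : Continuous fun ζ : W0 Ω => (∫ r in s..t, u' r) ζ := (∫ r in s..t, u' r).continuous
    rw [e ζ s hs t ht]
    refine congrFun ((TopologicalSpace.denseRange_denseSeq (W0 Ω)).equalizer c1 c2 ?_) ζ
    funext n
    have hs'' := hs' n
    have ht'' := ht' n
    simp only [Function.comp_apply]
    have i1 : IntervalIntegrable (fun r => u' r (D n)) volume s (T / 2) :=
      (hu'.apply (D n)).intervalIntegrable hs hm
    have i2 : IntervalIntegrable (fun r => u' r (D n)) volume (T / 2) t :=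
      (hu'.apply (D n)).intervalIntegrable hm ht
    have e3 := intervalIntegral.integral_add_adjacent_intervals i1 i2
    rw [← e _ s hs t ht, inner_sub_left]
    show ⟪(u t).fn, (D n).fn⟫_ℝ - ⟪(u s).fn, (D n).fn⟫_ℝ = ∫ r in s..t, u' r (D n)
    rw [hs'', ht'', ← e3, intervalIntegral.integral_symm s (T / 2)]
    ring

section Primitive

variable {H Θ : ℝ → ℝ} {α : Type*} {m : MeasurableSpace α} {μ : Measure α}

theorem integrable_comp_of_abs_sub_le (hL : ∀ x y, |Θ x - Θ y| ≤ |x - y|) (h0 : Θ 0 = 0)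
    {f : α → ℝ} (hf : Integrable f μ) : Integrable (fun x => Θ (f x)) μ := by
  have hc : Continuous Θ :=
    (LipschitzWith.of_dist_le_mul (K := 1) fun x y => by simpa [Real.dist_eq] using hL x y).continuous
  refine hf.mono (hc.comp_aestronglyMeasurable hf.1) (Eventually.of_forall fun x => ?_)
  simpa [h0] using hL (f x) 0

theorem abs_integral_comp_sub_le (hL : ∀ x y, |Θ x - Θ y| ≤ |x - y|) (h0 : Θ 0 = 0)
    (f g : Lp ℝ 1 μ) : |∫ x, Θ (f x) ∂μ - ∫ x, Θ (g x) ∂μ| ≤ ‖f - g‖ := by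
  have hf := L1.integrable_coeFn f
  have hg := L1.integrable_coeFn g
  rw [← integral_sub (integrable_comp_of_abs_sub_le hL h0 hf)
    (integrable_comp_of_abs_sub_le hL h0 hg), L1.norm_eq_integral_norm]
  refine (abs_integral_le_integral_abs).trans ?_
  refine integral_mono_ae ((integrable_comp_of_abs_sub_le hL h0 hf).sub
    (integrable_comp_of_abs_sub_le hL h0 hg)).abs (L1.integrable_coeFn _).norm ?_
  filter_upwards [Lp.coeFn_sub f g] with x hx
  rw [hx]
  exact hL _ _

theorem continuousOn_integral_comp (hL : ∀ x y, |Θ x - Θ y| ≤ |x - y|) (h0 : Θ 0 = 0)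
    {z : ℝ → Lp ℝ 1 μ} {s : Set ℝ} (hz : ContinuousOn z s) :
    ContinuousOn (fun t => ∫ x, Θ (z t x) ∂μ) s := by
  have : LipschitzWith 1 (fun f : Lp ℝ 1 μ => ∫ x, Θ (f x) ∂μ) :=
    LipschitzWith.of_dist_le_mul fun f g => by
      simpa [Real.dist_eq, dist_eq_norm] using abs_integral_comp_sub_le hL h0 f g
  exact this.continuous.comp_continuousOn hz

end Primitive

end DriftParabolic

/-! ### The convex half of the chain rule in time -/

namespace DriftParabolic

variable {N : ℕ} {Ω : Set (Eu N)} {T : ℝ}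

theorem ae_restrict_translate {p : ℝ → Prop} {S : Set ℝ} (hS : MeasurableSet S)
    (h : ∀ᵐ t ∂(volume.restrict S), p t) (c : ℝ) :
    ∀ᵐ t, t - c ∈ S → p (t - c) :=
  (measurePreserving_sub_right (volume : Measure ℝ) c).quasiMeasurePreserving.ae
    ((ae_restrict_iff' hS).1 h)

/-- One half of the chain rule `d/dt ∫ Θ(u) = ⟨u', Θ'(u)⟩` for convex `Θ`. -/
theorem integral_comp_sub_le_integral_pairing {z : ℝ → Lp ℝ 1 (volume.restrict Ω)}
    {u : ℝ → W0 Ω} {u' : ℝ → WNeg Ω} (hz : ContinuousOn z (Icc 0 T))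
    (hzu : ∀ᵐ t ∂(volume.restrict (Ioo 0 T)), ∀ᵐ x ∂(volume.restrict Ω), (u t).fn x = z t x)
    (hu : MemL2loc T u) (hu' : MemL2loc T u') (hd : HasWeakTimeDeriv T u u') {H Θ : ℝ → ℝ}
    (hΘ : ∀ x y, Θ y - Θ x ≤ H y * (y - x)) (hL : ∀ x y, |Θ x - Θ y| ≤ |x - y|) (h0 : Θ 0 = 0)
    {φ : ℝ → W0 Ω} {a b : ℝ} (ha : 0 < a) (hab : a < b) (hb : b < T) (hφ : MemL2 a b φ)
    (hφH : ∀ᵐ t ∂(volume.restrict (Ioo a b)), ∀ᵐ x ∂(volume.restrict Ω),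
      (φ t).fn x = H ((u t).fn x)) :
    (∫ x in Ω, Θ (z b x)) - ∫ x in Ω, Θ (z a x) ≤ ∫ t in a..b, u' t (φ t) := by
  obtain ⟨A, hAs, hA, hAe⟩ := hd.exists_ae_inner_sub_eq_integral
    (by linarith : 0 < T) hu hu'
  let G : ℝ → ℝ := fun t => ∫ x in Ω, Θ (z t x)
  have hG : ContinuousOn G (Icc 0 T) := continuousOn_integral_comp hL h0 hz
  -- For t in (a, b) and shifts s ≤ h < a/2, the time t - s stays in (a/2, b), so the cut-off never
  -- affects the pairings that occur.
  let U : ℝ → WNeg Ω := (Ioo (a / 2) b).indicator u'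
  let φ₀ : ℝ → W0 Ω := (Ioo a b).indicator φ
  have hU : MemLp U 2 volume := (memLp_indicator_iff_restrict measurableSet_Ioo).2
    (hu' _ _ (by linarith) (by linarith) hb)
  have hφ₀ : MemLp φ₀ 2 volume := (memLp_indicator_iff_restrict measurableSet_Ioo).2 hφ
  let J : ℝ → ℝ := fun s => ∫ t, U (t - s) (φ₀ t)
  have hJ : Continuous J := continuous_integral_pairing_translate hU hφ₀
  have hJ0 : J 0 = ∫ t in a..b, u' t (φ t) := by
    rw [intervalIntegral.integral_of_le hab.le, integral_Ioc_eq_integral_Ioo,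
      ← integral_indicator measurableSet_Ioo]
    refine integral_congr_ae (Eventually.of_forall fun t => ?_)
    by_cases ht : t ∈ Ioo a b
    · have ht2 : t ∈ Ioo (a / 2) b := ⟨by linarith [ht.1], ht.2⟩
      simp [U, φ₀, ht, ht2]
    · simp [φ₀, ht]
  have lim : Tendsto (fun h => (h⁻¹ * ∫ s in (b - h)..b, G s) - h⁻¹ * ∫ s in (a - h)..a, G s)
      (𝓝[>] 0) (𝓝 (G b - G a)) :=
    (tendsto_average_left (by linarith) hb hG).sub (tendsto_average_left ha (by linarith) hG)
  have limJ := tendsto_average_right hJ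
  rw [← hJ0]
  change G b - G a ≤ J 0
  refine le_of_tendsto_of_tendsto lim limJ ?_
  filter_upwards [Ioo_mem_nhdsGT (show 0 < a / 2 by linarith)] with h hh
  have hh1 := hh.1
  have hh2 := hh.2
  rw [← mul_sub]
  refine mul_le_mul_of_nonneg_left ?_ (inv_nonneg.2 hh1.le)
  have hGi : ∀ p q, 0 < p → p < T → 0 < q → q < T → IntervalIntegrable G volume p q := by
    intro p q h1 h2 h3 h4
    apply (hG.mono _).intervalIntegrable
    exact (ordConnected_Icc).uIcc_subset ⟨h1.le, h2.le⟩ ⟨h3.le, h4.le⟩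
  have hGh : IntervalIntegrable (fun t => G (t - h)) volume a b := by
    have := (hGi (a - h) (b - h) (by linarith) (by linarith) (by linarith)
      (by linarith)).comp_sub_right h
    simpa using this
  -- The integral over the overlap of (a, b) and its translate cancels, leaving the two end pieces.
  have e1 : (∫ s in (b - h)..b, G s) - ∫ s in (a - h)..a, G s =
      ∫ t in a..b, (G t - G (t - h)) := by
    rw [intervalIntegral.integral_sub (hGi a b ha (by linarith) (by linarith) hb) hGh,
      intervalIntegral.integral_comp_sub_right (fun t => G t) h]
    have i1 := intervalIntegral.integral_add_adjacent_intervals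
      (hGi (a - h) (b - h) (by linarith) (by linarith) (by linarith) (by linarith))
      (hGi (b - h) b (by linarith) (by linarith) (by linarith) (by linarith))
    have i2 := intervalIntegral.integral_add_adjacent_intervals
      (hGi (a - h) a (by linarith) (by linarith) (by linarith) (by linarith))
      (hGi a b (by linarith) (by linarith) (by linarith) (by linarith))
    linarith
  have hint := integrable_pairing_translate hU hφ₀ h
  have e2 : ∫ s in (0 : ℝ)..h, J s = ∫ t in a..b, ∫ s in Ioc 0 h, U (t - s) (φ₀ t) := by
    have e4 : ∫ t in Ioo a b, ∫ s in Ioc 0 h, U (t - s) (φ₀ t) =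
        ∫ t, ∫ s in Ioc 0 h, U (t - s) (φ₀ t) :=
      setIntegral_eq_integral_of_forall_compl_eq_zero fun t ht => by simp [φ₀, ht]
    rw [intervalIntegral.integral_of_le hh1.le, intervalIntegral.integral_of_le hab.le,
      integral_Ioc_eq_integral_Ioo (μ := volume) (x := a), e4]
    exact (integral_integral_swap (f := fun t s => U (t - s) (φ₀ t)) hint).symm
  rw [e1, e2]
  have hint2 : Integrable (fun t => ∫ s in Ioc 0 h, U (t - s) (φ₀ t)) := hint.integral_prod_left
  refine intervalIntegral.integral_mono_ae_restrict hab.le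
    ((hGi a b ha (by linarith) (by linarith) hb).sub hGh) hint2.intervalIntegrable ?_
  rw [← restrict_Ioo_eq_restrict_Icc]
  have hAh : ∀ᵐ t, t - h ∈ Ioo 0 T → t - h ∈ A :=
    ae_restrict_translate measurableSet_Ioo ((ae_restrict_iff' measurableSet_Ioo).2 hA) h
  have hzh := ae_restrict_translate measurableSet_Ioo hzu h
  rw [EventuallyLE, ae_restrict_iff' measurableSet_Ioo]
  filter_upwards [hA, hAh, hzh, (ae_restrict_iff' measurableSet_Ioo).1 hzu,
    (ae_restrict_iff' measurableSet_Ioo).1 hφH] with t k1 k2 k3 k4 k5 ht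
  have htT : t ∈ Ioo 0 T := ⟨by linarith [ht.1], by linarith [ht.2]⟩
  have hthT : t - h ∈ Ioo 0 T := ⟨by linarith [ht.1], by linarith [ht.2]⟩
  specialize k1 htT
  specialize k2 hthT
  specialize k3 hthT
  specialize k4 htT
  specialize k5 ht
  -- With φ frozen at time t, the average over shifts is the integral of u' over (t - h, t), that
  -- is, an increment of u paired with φ(t).
  have e3 : ∫ s in Ioc 0 h, U (t - s) (φ₀ t) = ∫ r in (t - h)..t, u' r (φ t) := by
    rw [← intervalIntegral.integral_of_le hh1.le]
    have := intervalIntegral.integral_comp_sub_left (a := 0) (b := h) (fun r => u' r (φ t)) t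
    rw [sub_zero] at this
    rw [← this]
    refine intervalIntegral.integral_congr_ae (Eventually.of_forall fun s hs => ?_)
    rw [uIoc_of_le hh1.le] at hs
    have h2 : t - s ∈ Ioo (a / 2) b := ⟨by linarith [ht.1, hs.2], by linarith [ht.2, hs.1]⟩
    simp only [U, φ₀, indicator_of_mem ht, indicator_of_mem h2]
  rw [e3, ← hAe _ k2 _ k1, L2.inner_def]
  simp only [G]
  rw [← integral_sub (integrable_comp_of_abs_sub_le hL h0 (L1.integrable_coeFn _))
    (integrable_comp_of_abs_sub_le hL h0 (L1.integrable_coeFn _))]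
  refine integral_mono_ae ((integrable_comp_of_abs_sub_le hL h0 (L1.integrable_coeFn _)).sub
    (integrable_comp_of_abs_sub_le hL h0 (L1.integrable_coeFn _))) (L2.integrable_inner _ _) ?_
  filter_upwards [k3, k4, k5, Lp.coeFn_sub (u t).fn (u (t - h)).fn] with x j3 j4 j5 j6
  rw [j6, Pi.sub_apply, j5, j4, j3]
  -- Convexity is used with the slope H at the later time t, which is where φ is evaluated.
  simpa [mul_comm] using hΘ (z (t - h) x) (z t x)

end DriftParabolic

/-! ### Continuity of composition operators on L² -/

section Nemytskii

variable {α : Type*} {m : MeasurableSpace α} {μ : Measure α} {X : Type*} [NormedAddCommGroup X]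
  [InnerProductSpace ℝ X] {h : ℝ → ℝ} {L : ℝ}

theorem memLp_comp_smul (hc : Continuous h) (hb : ∀ s, |h s| ≤ L) (f : Lp ℝ 2 μ) (G : Lp X 2 μ) :
    MemLp (fun x => h (f x) • G x) 2 μ := by
  refine (Lp.memLp G).of_le_mul (c := L)
    ((hc.comp_aestronglyMeasurable (Lp.aestronglyMeasurable f)).smul (Lp.aestronglyMeasurable G))
    (Eventually.of_forall fun x => ?_)
  rw [norm_smul]
  exact mul_le_mul_of_nonneg_right (hb _) (norm_nonneg _)

/-- The product `h(f) G` of a bounded continuous function of `f ∈ L²` with `G ∈ L²`. -/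
noncomputable def compSmul (hc : Continuous h) (hb : ∀ s, |h s| ≤ L) (f : Lp ℝ 2 μ)
    (G : Lp X 2 μ) : Lp X 2 μ :=
  (memLp_comp_smul hc hb f G).toLp _

theorem coeFn_compSmul (hc : Continuous h) (hb : ∀ s, |h s| ≤ L) (f : Lp ℝ 2 μ) (G : Lp X 2 μ) :
    compSmul hc hb f G =ᵐ[μ] fun x => h (f x) • G x :=
  MemLp.coeFn_toLp _

theorem L2_norm_sq_eq_integral (G : Lp X 2 μ) : ‖G‖ ^ 2 = ∫ x, ‖G x‖ ^ 2 ∂μ := by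
  rw [← real_inner_self_eq_norm_sq, L2.inner_def]
  exact integral_congr_ae (Eventually.of_forall fun x => real_inner_self_eq_norm_sq _)

theorem exists_subseq_ae_tendsto_of_tendsto_Lp {p : ℝ≥0∞} [Fact (1 ≤ p)] {Y : Type*}
    [NormedAddCommGroup Y] {f : ℕ → Lp Y p μ} {g : Lp Y p μ} (hfg : Tendsto f atTop (𝓝 g)) :
    ∃ ms : ℕ → ℕ, StrictMono ms ∧ ∀ᵐ x ∂μ, Tendsto (fun n => f (ms n) x) atTop (𝓝 (g x)) :=
  (tendstoInMeasure_of_tendsto_Lp hfg).exists_seq_tendsto_ae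

/-- Every subsequence has a further one converging almost everywhere, along which dominated
convergence applies with majorant (2L)² |G|². -/
theorem tendsto_compSmul_left (hc : Continuous h) (hb : ∀ s, |h s| ≤ L) {f : ℕ → Lp ℝ 2 μ}
    {g : Lp ℝ 2 μ} (hfg : Tendsto f atTop (𝓝 g)) (G : Lp X 2 μ) :
    Tendsto (fun n => compSmul hc hb (f n) G) atTop (𝓝 (compSmul hc hb g G)) := by
  refine tendsto_of_subseq_tendsto fun ns hns => ?_
  obtain ⟨ms, -, hms⟩ := exists_subseq_ae_tendsto_of_tendsto_Lp (hfg.comp hns)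
  refine ⟨ms, ?_⟩
  rw [tendsto_iff_norm_sub_tendsto_zero]
  have key : Tendsto
      (fun n => ‖compSmul hc hb (f (ns (ms n))) G - compSmul hc hb g G‖ ^ 2) atTop (𝓝 0) := by
    have hGi : Integrable (fun x => ‖G x‖ ^ 2) μ := (Lp.memLp G).integrable_norm_pow (by simp)
    have := tendsto_integral_of_dominated_convergence (μ := μ)
      (F := fun n x => ‖(compSmul hc hb (f (ns (ms n))) G - compSmul hc hb g G : Lp X 2 μ) x‖ ^ 2)
      (f := fun _ => (0 : ℝ)) (fun x => (2 * L) ^ 2 * ‖G x‖ ^ 2)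
      (fun n => ((Lp.aestronglyMeasurable _).norm.pow 2)) (hGi.const_mul _) ?_ ?_
    · simpa [L2_norm_sq_eq_integral] using this
    · intro n
      filter_upwards [Lp.coeFn_sub (compSmul hc hb (f (ns (ms n))) G) (compSmul hc hb g G),
        coeFn_compSmul hc hb (f (ns (ms n))) G, coeFn_compSmul hc hb g G] with x h1 h2 h3
      rw [h1, Pi.sub_apply, h2, h3, ← sub_smul, Real.norm_of_nonneg (by positivity), norm_smul,
        mul_pow]
      refine mul_le_mul_of_nonneg_right ?_ (by positivity)
      refine pow_le_pow_left₀ (norm_nonneg _) ?_ 2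
      refine (norm_sub_le _ _).trans ?_
      have e1 := hb ((f (ns (ms n))) x)
      have e2 := hb (g x)
      rw [Real.norm_eq_abs, Real.norm_eq_abs]
      linarith
    · have hall : ∀ᵐ x ∂μ, ∀ n, (compSmul hc hb (f (ns (ms n))) G - compSmul hc hb g G : Lp X 2 μ) x
          = h (f (ns (ms n)) x) • G x - h (g x) • G x := by
        refine ae_all_iff.2 fun n => ?_
        filter_upwards [Lp.coeFn_sub (compSmul hc hb (f (ns (ms n))) G) (compSmul hc hb g G),
          coeFn_compSmul hc hb (f (ns (ms n))) G, coeFn_compSmul hc hb g G] with x h1 h2 h3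
        rw [h1, Pi.sub_apply, h2, h3]
      filter_upwards [hms, hall] with x h1 h2
      simp only [h2]
      have e1 : Tendsto (fun n => h (f (ns (ms n)) x) • G x - h (g x) • G x) atTop
          (𝓝 (h (g x) • G x - h (g x) • G x)) :=
        (((hc.tendsto _).comp h1).smul_const _).sub_const _
      simpa using e1.norm.pow 2
  have := key.sqrt
  simpa [Real.sqrt_sq (norm_nonneg _)] using this

theorem norm_compSmul_sub_le (hc : Continuous h) (hb : ∀ s, |h s| ≤ L) (f : Lp ℝ 2 μ)
    (G G' : Lp X 2 μ) : ‖compSmul hc hb f G - compSmul hc hb f G'‖ ≤ L * ‖G - G'‖ := by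
  refine Lp.norm_le_mul_norm_of_ae_le_mul ?_
  filter_upwards [Lp.coeFn_sub (compSmul hc hb f G) (compSmul hc hb f G'), Lp.coeFn_sub G G',
    coeFn_compSmul hc hb f G, coeFn_compSmul hc hb f G'] with x h1 h2 h3 h4
  rw [h1, h2, Pi.sub_apply, Pi.sub_apply, h3, h4, ← smul_sub, norm_smul]
  exact mul_le_mul_of_nonneg_right (hb _) (norm_nonneg _)

/-- Splits h(fₙ) Gₙ - h(f) G into h(fₙ)(Gₙ - G), small because h is bounded, and (h(fₙ) - h(f)) G,
where G is fixed. -/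
theorem continuous_compSmul (hc : Continuous h) (hb : ∀ s, |h s| ≤ L) :
    Continuous (fun p : Lp ℝ 2 μ × Lp X 2 μ => compSmul hc hb p.1 p.2) := by
  rw [continuous_iff_seqContinuous]
  intro p q hpq
  have h1 : Tendsto (fun n => (p n).1) atTop (𝓝 q.1) := (continuous_fst.tendsto q).comp hpq
  have h2 : Tendsto (fun n => (p n).2) atTop (𝓝 q.2) := (continuous_snd.tendsto q).comp hpq
  have h3 := tendsto_compSmul_left hc hb h1 q.2
  have h4 : Tendsto (fun n => compSmul hc hb (p n).1 (p n).2 - compSmul hc hb (p n).1 q.2) atTop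
      (𝓝 0) := by
    rw [tendsto_zero_iff_norm_tendsto_zero]
    refine squeeze_zero (fun _ => norm_nonneg _)
      (fun n => norm_compSmul_sub_le hc hb (p n).1 (p n).2 q.2) ?_
    have := (tendsto_iff_norm_sub_tendsto_zero.1 h2).const_mul L
    simpa using this
  simpa [Function.comp_def] using h4.add h3

/-- Integration against an `L¹` function is continuous for `L²` convergence of bounded functions. -/
theorem tendsto_integral_mul_of_bounded {f : α → ℝ} (hf : Integrable f μ) {ζ : ℕ → Lp ℝ 2 μ}
    {η : Lp ℝ 2 μ} (hζ : Tendsto ζ atTop (𝓝 η)) {C : ℝ} (hC : ∀ n, ∀ᵐ x ∂μ, |ζ n x| ≤ C) :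
    Tendsto (fun n => ∫ x, f x * ζ n x ∂μ) atTop (𝓝 (∫ x, f x * η x ∂μ)) := by
  refine tendsto_of_subseq_tendsto fun ns hns => ?_
  obtain ⟨ms, -, hms⟩ := exists_subseq_ae_tendsto_of_tendsto_Lp (hζ.comp hns)
  refine ⟨ms, ?_⟩
  refine tendsto_integral_of_dominated_convergence (fun x => ‖f x‖ * C)
    (fun n => hf.1.mul (Lp.aestronglyMeasurable _)) (hf.norm.mul_const C) (fun n => ?_) ?_
  · filter_upwards [hC (ns (ms n))] with x hx
    rw [norm_mul]
    exact mul_le_mul_of_nonneg_left hx (norm_nonneg _)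
  · filter_upwards [hms] with x hx
    exact hx.const_mul _

end Nemytskii

theorem ContDiff.continuous_deriv_of_infty {H : ℝ → ℝ} (hH : ContDiff ℝ ∞ H) :
    Continuous (deriv H) :=
  (contDiff_infty_iff_deriv.1 hH).2.continuous

/-! ### The chain rule in `W0` -/

namespace DriftParabolic

variable {N : ℕ} {Ω : Set (Eu N)} {H : ℝ → ℝ} {L : NNReal}

theorem lipschitzWith_of_abs_deriv_le (hH : ContDiff ℝ ∞ H) (hb : ∀ s, |deriv H s| ≤ L) :
    LipschitzWith L H :=
  lipschitzWith_of_nnnorm_deriv_le (hH.differentiable (by simp)) fun s => by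
    rw [← NNReal.coe_le_coe]
    simpa using hb s

/-- The map `(u, F) ↦ (H(u), H'(u) F)` on `L²(Ω) × L²(Ω; ℝ^N)`. -/
noncomputable def compPair (hH : ContDiff ℝ ∞ H) (hb : ∀ s, |deriv H s| ≤ L) (h0 : H 0 = 0)
    (p : L2Pair Ω) : L2Pair Ω :=
  WithLp.toLp 2 ((lipschitzWith_of_abs_deriv_le hH hb).compLp h0 p.fst,
    compSmul hH.continuous_deriv_of_infty hb p.fst p.snd)

theorem continuous_compPair (hH : ContDiff ℝ ∞ H) (hb : ∀ s, |deriv H s| ≤ L) (h0 : H 0 = 0) :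
    Continuous (compPair (Ω := Ω) hH hb h0) := by
  refine (WithLp.prod_continuous_toLp 2 _ _).comp ?_
  have h1 : Continuous fun p : L2Pair Ω => p.fst := (WithLp.fstL 2 ℝ _ _).continuous
  have h2 : Continuous fun p : L2Pair Ω => p.snd := (WithLp.sndL 2 ℝ _ _).continuous
  exact ((LipschitzWith.continuous_compLp _ _).comp h1).prodMk
    ((continuous_compSmul hH.continuous_deriv_of_infty hb).comp (h1.prodMk h2))

/-- For test functions this is the classical chain rule, and H(0) = 0 keeps the support of H ∘ η
inside that of η. Continuity of `compPair` then extends it to the closure. -/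
theorem mapsTo_compPair_testGraph (hH : ContDiff ℝ ∞ H) (hb : ∀ s, |deriv H s| ≤ L)
    (h0 : H 0 = 0) : MapsTo (compPair hH hb h0) (testGraph Ω : Set (L2Pair Ω)) (testGraph Ω) := by
  rintro p ⟨η, ⟨h1, h2, h3⟩, h4, h5⟩
  have hs : Function.support (H ∘ η) ⊆ Function.support η := Function.support_comp_subset h0 η
  refine ⟨H ∘ η, ⟨hH.comp h1, h2.comp_left h0, (closure_mono hs).trans h3⟩, ?_, ?_⟩
  · filter_upwards [h4, (lipschitzWith_of_abs_deriv_le hH hb).coeFn_compLp h0 p.fst] with x e1 e2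
    change ((lipschitzWith_of_abs_deriv_le hH hb).compLp h0 p.fst) x = _
    rw [e2, Function.comp_apply, e1, Function.comp_apply]
  · filter_upwards [h4, h5, coeFn_compSmul hH.continuous_deriv_of_infty hb p.fst
      p.snd] with x e1 e2 e3
    change (compSmul hH.continuous_deriv_of_infty hb p.fst p.snd) x = _
    rw [e3, e1, e2]
    have := ((hH.differentiable (by simp)) (η x)).hasDerivAt.comp_hasFDerivAt x
      ((h1.differentiable (by simp)) x).hasFDerivAt
    rw [gradient, gradient, this.fderiv, map_smul]

/-- The chain rule in `W^{1,2}_0(Ω)`: the composition `H(u)`, with weak gradient `H'(u) ∇u`. -/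
noncomputable def W0.comp (hH : ContDiff ℝ ∞ H) (hb : ∀ s, |deriv H s| ≤ L) (h0 : H 0 = 0)
    (u : W0 Ω) : W0 Ω :=
  ⟨compPair hH hb h0 u, (mapsTo_compPair_testGraph hH hb h0).closure
    (continuous_compPair hH hb h0) u.2⟩

theorem W0.continuous_comp (hH : ContDiff ℝ ∞ H) (hb : ∀ s, |deriv H s| ≤ L) (h0 : H 0 = 0) :
    Continuous (W0.comp (Ω := Ω) hH hb h0) :=
  ((continuous_compPair hH hb h0).comp continuous_subtype_val).subtype_mk _

theorem W0.coeFn_comp (hH : ContDiff ℝ ∞ H) (hb : ∀ s, |deriv H s| ≤ L) (h0 : H 0 = 0)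
    (u : W0 Ω) : ∀ᵐ x ∂(volume.restrict Ω), (u.comp hH hb h0).fn x = H (u.fn x) :=
  (lipschitzWith_of_abs_deriv_le hH hb).coeFn_compLp h0 u.fn

theorem W0.coeFn_grad_comp (hH : ContDiff ℝ ∞ H) (hb : ∀ s, |deriv H s| ≤ L) (h0 : H 0 = 0)
    (u : W0 Ω) : ∀ᵐ x ∂(volume.restrict Ω),
      (u.comp hH hb h0).grad x = deriv H (u.fn x) • u.grad x :=
  coeFn_compSmul hH.continuous_deriv_of_infty hb u.fn u.grad

theorem W0.norm_comp_le (hH : ContDiff ℝ ∞ H) (hb : ∀ s, |deriv H s| ≤ L) (h0 : H 0 = 0)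
    (u : W0 Ω) : ‖u.comp hH hb h0‖ ≤ L * ‖u‖ := by
  have h1 : ‖(u.comp hH hb h0).fn‖ ≤ L * ‖u.fn‖ :=
    LipschitzWith.norm_compLp_le (lipschitzWith_of_abs_deriv_le hH hb) h0 u.fn
  have h2 : ‖(u.comp hH hb h0).grad‖ ≤ L * ‖u.grad‖ := by
    refine Lp.norm_le_mul_norm_of_ae_le_mul ?_
    filter_upwards [u.coeFn_grad_comp hH hb h0] with x e
    rw [e, norm_smul]
    exact mul_le_mul_of_nonneg_right (hb _) (norm_nonneg _)
  have e : ∀ w : W0 Ω, ‖w‖ ^ 2 = ‖w.fn‖ ^ 2 + ‖w.grad‖ ^ 2 := fun w =>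
    WithLp.prod_norm_sq_eq_of_L2 (w : L2Pair Ω)
  refine le_of_sq_le_sq ?_ (by positivity)
  rw [mul_pow, e, e, mul_add, ← mul_pow, ← mul_pow]
  gcongr

end DriftParabolic

/-! ### Jointly measurable representatives of curves in L^p -/

section JointRepresentative

variable {α β X : Type*} {mα : MeasurableSpace α} {mβ : MeasurableSpace β} {ν : Measure α}
  {μ : Measure β} [NormedAddCommGroup X] {p : ℝ≥0∞}

/-- Functions taking countably many values in L^p are jointly measurable. Approximating z(t) by them
at the summable rate 2⁻ⁿ forces convergence at almost every x for every t, with no subsequence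
depending on t. -/
theorem MeasureTheory.StronglyMeasurable.exists_uncurry_of_Lp [CompleteSpace X] [SecondCountableTopology X]
    [MeasurableSpace X] [BorelSpace X] [Fact (1 ≤ p)] [Fact (p ≠ ⊤)] [IsSeparable μ]
    {z : α → Lp X p μ} (hz : StronglyMeasurable z) :
    ∃ Z : α × β → X, StronglyMeasurable Z ∧ ∀ t, ∀ᵐ x ∂μ, Z (t, x) = z t x := by
  classical
  borelize ↥(Lp X p μ)
  let d := TopologicalSpace.denseSeq (Lp X p μ)
  have hd : DenseRange d := TopologicalSpace.denseRange_denseSeq _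
  have hex : ∀ n : ℕ, ∀ t : α, ∃ k, dist (z t) (d k) < (1 / 2 : ℝ) ^ n := fun n t =>
    hd.exists_dist_lt _ (by positivity)
  let k : ℕ → α → ℕ := fun n t => Nat.find (hex n t)
  have hk : ∀ n, Measurable (k n) := fun n =>
    measurable_find (hex n) fun j =>
      _root_.measurableSet_lt (hz.measurable.dist measurable_const) measurable_const
  have hkd : ∀ n t, dist (z t) (d (k n t)) < (1 / 2 : ℝ) ^ n := fun n t => Nat.find_spec (hex n t)
  let Zn : ℕ → α × β → X := fun n q => d (k n q.1) q.2
  have hZn : ∀ n, StronglyMeasurable (Zn n) := by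
    intro n
    have h1 : Measurable (fun q : ℕ × β => d q.1 q.2) :=
      measurable_from_prod_countable_right fun j => (Lp.stronglyMeasurable (d j)).measurable
    exact (h1.comp (((hk n).comp measurable_fst).prodMk measurable_snd)).stronglyMeasurable
  -- `limUnder` is measurable whether or not the limit exists.
  refine ⟨fun q => limUnder atTop fun n => Zn n q, StronglyMeasurable.limUnder hZn, fun t => ?_⟩
  have htend : Tendsto (fun n => d (k n t)) atTop (𝓝 (z t)) := by
    rw [tendsto_iff_dist_tendsto_zero]
    refine squeeze_zero (fun _ => dist_nonneg) (fun n => ?_)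
      (tendsto_pow_atTop_nhds_zero_of_lt_one (by norm_num : (0 : ℝ) ≤ 1 / 2) (by norm_num))
    rw [dist_comm]
    exact (hkd n t).le
  -- The subsequence depends on t, but serves only to identify the limit.
  obtain ⟨ms, hms, hsub⟩ := exists_subseq_ae_tendsto_of_tendsto_Lp htend
  have hconv := Lp.ae_tendsto_of_cauchy_eLpNorm (μ := μ) (p := p)
    (f := fun n => (d (k n t) : β → X)) (fun n => Lp.aestronglyMeasurable _) Fact.out
    (B := fun n => ENNReal.ofReal (2 * (1 / 2 : ℝ) ^ n)) ?_ ?_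
  · filter_upwards [hconv, hsub] with x h1 h2
    obtain ⟨l, hl⟩ := h1
    have e : l = z t x := tendsto_nhds_unique (hl.comp hms.tendsto_atTop) h2
    rw [← e]
    exact hl.limUnder_eq
  · rw [← ENNReal.ofReal_tsum_of_nonneg (fun n => by positivity)
      ((summable_geometric_of_lt_one (by norm_num) (by norm_num)).mul_left 2)]
    exact ENNReal.ofReal_ne_top
  · intro M n m hn hm
    have e1 : eLpNorm ((d (k n t) : β → X) - (d (k m t) : β → X)) p μ
        = ENNReal.ofReal (dist (d (k n t)) (d (k m t))) := by
      rw [Lp.dist_def, ENNReal.ofReal_toReal]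
      exact ((Lp.memLp _).sub (Lp.memLp _)).2.ne
    rw [e1]
    refine (ENNReal.ofReal_lt_ofReal_iff (by positivity)).2 ?_
    have h1 := hkd n t
    have h2 := hkd m t
    have h3 := dist_triangle_left (d (k n t)) (d (k m t)) (z t)
    have h4 : (1 / 2 : ℝ) ^ n ≤ (1 / 2 : ℝ) ^ M :=
      pow_le_pow_of_le_one (by norm_num) (by norm_num) hn
    have h5 : (1 / 2 : ℝ) ^ m ≤ (1 / 2 : ℝ) ^ M :=
      pow_le_pow_of_le_one (by norm_num) (by norm_num) hm
    linarith

/-- A measurable function with values in `L^p` has a jointly measurable representative. -/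
theorem MeasureTheory.AEStronglyMeasurable.exists_uncurry_of_Lp [CompleteSpace X] [SecondCountableTopology X]
    [MeasurableSpace X] [BorelSpace X] [Fact (1 ≤ p)] [Fact (p ≠ ⊤)] [IsSeparable μ]
    {z : α → Lp X p μ} (hz : AEStronglyMeasurable z ν) :
    ∃ Z : α × β → X, StronglyMeasurable Z ∧ ∀ᵐ t ∂ν, ∀ᵐ x ∂μ, Z (t, x) = z t x := by
  obtain ⟨Z, h1, h2⟩ := StronglyMeasurable.exists_uncurry_of_Lp hz.stronglyMeasurable_mk
  refine ⟨Z, h1, ?_⟩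
  filter_upwards [hz.ae_eq_mk] with t ht
  rw [ht]
  exact h2 t

theorem memLp_two_prod_of_ae_eq [SFinite μ] {z : α → Lp X 2 μ} (hz : MemLp z 2 ν)
    {Z : α × β → X} (hZ : AEStronglyMeasurable Z (ν.prod μ))
    (h : ∀ᵐ t ∂ν, ∀ᵐ x ∂μ, Z (t, x) = z t x) : MemLp Z 2 (ν.prod μ) := by
  refine ⟨hZ, ?_⟩
  rw [eLpNorm_lt_top_iff_lintegral_rpow_enorm_lt_top (by simp) (by simp)]
  have hz2 := hz.2
  rw [eLpNorm_lt_top_iff_lintegral_rpow_enorm_lt_top (by simp) (by simp)] at hz2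
  rw [lintegral_prod _ (hZ.enorm.pow_const _)]
  refine lt_of_eq_of_lt (lintegral_congr_ae ?_) hz2
  filter_upwards [h] with t ht
  rw [Lp.enorm_def, eLpNorm_eq_lintegral_rpow_enorm_toReal (by simp) (by simp), ← ENNReal.rpow_mul]
  simp only [ENNReal.toReal_ofNat, one_div]
  rw [inv_mul_cancel₀ (by norm_num), ENNReal.rpow_one]
  refine lintegral_congr_ae ?_
  filter_upwards [ht] with x hx
  rw [hx]

end JointRepresentative

/-! ### From inequalities integrated in time to inequalities at almost every time -/

/-- A locally integrable function with nonpositive integrals is nonpositive. -/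
theorem ae_nonpos_of_forall_intervalIntegral_nonpos {r : ℝ → ℝ} {a b : ℝ}
    (hr : LocallyIntegrableOn r (Ioo a b))
    (h : ∀ s t, a < s → s < t → t < b → ∫ x in s..t, r x ≤ 0) :
    ∀ᵐ t ∂(volume.restrict (Ioo a b)), r t ≤ 0 := by
  rw [ae_restrict_iff' measurableSet_Ioo]
  refine ae_of_mem_of_ae_of_mem_inter_Ioo fun p q hp hq hpq => ?_
  have hi : IntervalIntegrable r volume p q := by
    rw [intervalIntegrable_iff_integrableOn_Icc_of_le hpq.le]
    exact hr.integrableOn_compact_subset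
      (fun t ht => ⟨hp.1.trans_le ht.1, ht.2.trans_lt hq.2⟩) isCompact_Icc
  -- By Lebesgue differentiation, r(x) is almost everywhere the limit of averages over [x, x + y],
  -- which are nonpositive.
  filter_upwards [hi.ae_hasDerivAt_integral] with x hx hx2
  have hxm : x ∈ uIcc p q := by
    rw [uIcc_of_le hpq.le]; exact ⟨hx2.2.1.le, hx2.2.2.le⟩
  have := (hx hxm x hxm).tendsto_slope_zero_right
  refine le_of_tendsto this ?_
  filter_upwards [Ioo_mem_nhdsGT (show 0 < q - x by linarith [hx2.2.2])] with y hy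
  simp only [intervalIntegral.integral_same, sub_zero, smul_eq_mul]
  exact mul_nonpos_of_nonneg_of_nonpos (inv_nonneg.2 hy.1.le)
    (h _ _ hx2.1.1 (by linarith [hy.1]) (by linarith [hy.2, hq.2]))

theorem ae_restrict_Ioo_of_forall_Ioo_subset {T : ℝ} {p : ℝ → Prop}
    (h : ∀ a b, 0 < a → a < b → b < T → ∀ᵐ t ∂(volume.restrict (Ioo a b)), p t) :
    ∀ᵐ t ∂(volume.restrict (Ioo 0 T)), p t := by
  rw [ae_restrict_iff' measurableSet_Ioo]
  refine ae_of_mem_of_ae_of_mem_inter_Ioo fun a b ha hb hab => ?_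
  filter_upwards [(ae_restrict_iff' measurableSet_Ioo).1 (h a b ha.1 hab hb.2)] with x hx hx2
  exact hx hx2.2

theorem locallyIntegrableOn_of_forall_Ioo_subset {T : ℝ} {X : Type*} [NormedAddCommGroup X]
    {r : ℝ → X} (h : ∀ a b, 0 < a → a < b → b < T → IntegrableOn r (Ioo a b)) :
    LocallyIntegrableOn r (Ioo 0 T) := by
  intro t ht
  refine ⟨Ioo (t / 2) ((t + T) / 2), mem_nhdsWithin_of_mem_nhds
    (Ioo_mem_nhds (by linarith [ht.1]) (by linarith [ht.2])), ?_⟩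
  exact h _ _ (by linarith [ht.1]) (by linarith [ht.1, ht.2]) (by linarith [ht.2])

section MemLpTwo

variable {α β X : Type*} {mα : MeasurableSpace α} {mβ : MeasurableSpace β} {ν : Measure α}
  {μ : Measure β} [NormedAddCommGroup X]

theorem MeasureTheory.MemLp.integrable_inner_two [InnerProductSpace ℝ X] {f g : α → X}
    (hf : MemLp f 2 ν) (hg : MemLp g 2 ν) : Integrable (fun x => ⟪f x, g x⟫_ℝ) ν := by
  rw [← memLp_one_iff_integrable]
  refine MemLp.of_bilin (p := 2) (q := 2) (fun x y : X => ⟪x, y⟫_ℝ) 1 hf hg (hf.1.inner hg.1)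
    (Eventually.of_forall fun x => ?_)
  simpa using nnnorm_inner_le_nnnorm (𝕜 := ℝ) (f x) (g x)

theorem MeasureTheory.MemLp.ae_memLp_two_section [SFinite ν] [SFinite μ] {F : α × β → X}
    (hF : MemLp F 2 (ν.prod μ)) : ∀ᵐ t ∂ν, MemLp (fun x => F (t, x)) 2 μ := by
  filter_upwards [hF.1.prodMk_left, (hF.integrable_norm_pow (by simp)).prod_right_ae] with t h1 h2
  exact (memLp_two_iff_integrable_sq_norm h1).2 h2

end MemLpTwo

namespace DriftParabolic

variable {N : ℕ} {Ω : Set (Eu N)} {T : ℝ}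

/-- The elements of `W^{1,2}_0(Ω)` with values in `[0,1]`. -/
def unitBounded (Ω : Set (Eu N)) : Set (W0 Ω) :=
  {ζ | ∀ᵐ x ∂(volume.restrict Ω), 0 ≤ ζ.fn x ∧ ζ.fn x ≤ 1}

theorem zero_mem_unitBounded : (0 : W0 Ω) ∈ unitBounded Ω := by
  have : (0 : W0 Ω).fn = 0 := map_zero (W0.fnL Ω)
  filter_upwards [Lp.coeFn_zero ℝ 2 (volume.restrict Ω)] with x hx
  rw [this, hx]
  simp

theorem ae_abs_fn_le_one {ζ : W0 Ω} (hζ : ζ ∈ unitBounded Ω) :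
    ∀ᵐ x ∂(volume.restrict Ω), |ζ.fn x| ≤ 1 := by
  filter_upwards [hζ] with x hx
  rw [abs_of_nonneg hx.1]
  exact hx.2

theorem integrable_inner_grad {a b : ℝ} {F : ℝ × Eu N → Eu N}
    (hF : MemLp F 2 ((volume.restrict (Ioo a b)).prod (volume.restrict Ω))) (ζ : W0 Ω) :
    Integrable (fun p : ℝ × Eu N => ⟪F p, ζ.grad p.2⟫_ℝ)
      ((volume.restrict (Ioo a b)).prod (volume.restrict Ω)) :=
  hF.integrable_inner_two ((Lp.memLp ζ.grad).comp_snd _)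

theorem integrable_mul_fn {a b : ℝ} {k : ℝ × Eu N → ℝ}
    (hk : Integrable k ((volume.restrict (Ioo a b)).prod (volume.restrict Ω))) {ζ : W0 Ω}
    (hζ : ζ ∈ unitBounded Ω) :
    Integrable (fun p : ℝ × Eu N => k p * ζ.fn p.2)
      ((volume.restrict (Ioo a b)).prod (volume.restrict Ω)) := by
  refine hk.mul_bdd (c := 1) (Lp.aestronglyMeasurable ζ.fn).comp_snd ?_
  exact Measure.quasiMeasurePreserving_snd.ae (ae_abs_fn_le_one hζ)

/-- A variational inequality tested with functions constant in time holds for almost every time,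
with a test function which may depend on that time. -/
theorem ae_forall_unitBounded_le {u' : ℝ → WNeg Ω} (hu' : MemL2loc T u') {F : ℝ × Eu N → Eu N}
    (hF : ∀ a b, 0 < a → a < b → b < T →
      MemLp F 2 ((volume.restrict (Ioo a b)).prod (volume.restrict Ω)))
    {k : ℝ × Eu N → ℝ}
    (hk : Integrable k ((volume.restrict (Ioo 0 T)).prod (volume.restrict Ω)))
    (h : ∀ ζ ∈ unitBounded Ω, ∀ t₁ t₂, 0 < t₁ → t₁ < t₂ → t₂ < T →
      (∫ t in t₁..t₂, u' t ζ) + (∫ t in t₁..t₂, ∫ x in Ω, ⟪F (t, x), ζ.grad x⟫_ℝ) ≤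
        ∫ t in t₁..t₂, ∫ x in Ω, k (t, x) * ζ.fn x) :
    ∀ᵐ t ∂(volume.restrict (Ioo 0 T)), ∀ ζ ∈ unitBounded Ω,
      u' t ζ + ∫ x in Ω, ⟪F (t, x), ζ.grad x⟫_ℝ ≤ ∫ x in Ω, k (t, x) * ζ.fn x := by
  have hone : ∀ ζ ∈ unitBounded Ω, ∀ᵐ t ∂(volume.restrict (Ioo 0 T)),
      u' t ζ + ∫ x in Ω, ⟪F (t, x), ζ.grad x⟫_ℝ ≤ ∫ x in Ω, k (t, x) * ζ.fn x := by
    intro ζ hζ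
    have i1 : ∀ a b, 0 < a → a < b → b < T → IntegrableOn (fun t => u' t ζ) (Ioo a b) :=
      fun a b h1 h2 h3 =>
        ((hu'.apply ζ) a b h1 h2 h3).integrableOn
    have i2 : ∀ a b, 0 < a → a < b → b < T →
        IntegrableOn (fun t => ∫ x in Ω, ⟪F (t, x), ζ.grad x⟫_ℝ) (Ioo a b) :=
      fun a b h1 h2 h3 => (integrable_inner_grad (hF a b h1 h2 h3) ζ).integral_prod_left
    have i3 : ∀ a b, 0 < a → a < b → b < T →
        IntegrableOn (fun t => ∫ x in Ω, k (t, x) * ζ.fn x) (Ioo a b) :=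
      fun a b h1 h2 h3 => IntegrableOn.mono_set (t := Ioo 0 T)
        (integrable_mul_fn hk hζ).integral_prod_left (Ioo_subset_Ioo h1.le h3.le)
    have := ae_nonpos_of_forall_intervalIntegral_nonpos (a := 0) (b := T)
      (r := fun t => u' t ζ + (∫ x in Ω, ⟪F (t, x), ζ.grad x⟫_ℝ) - ∫ x in Ω, k (t, x) * ζ.fn x)
      (locallyIntegrableOn_of_forall_Ioo_subset fun a b h1 h2 h3 =>
        ((i1 a b h1 h2 h3).add (i2 a b h1 h2 h3)).sub (i3 a b h1 h2 h3)) ?_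
    · filter_upwards [this] with t ht
      linarith
    · intro s t hs hst ht
      have j1 := (intervalIntegrable_iff_integrableOn_Ioo_of_le hst.le).2 (i1 s t hs hst ht)
      have j2 := (intervalIntegrable_iff_integrableOn_Ioo_of_le hst.le).2 (i2 s t hs hst ht)
      have j3 := (intervalIntegrable_iff_integrableOn_Ioo_of_le hst.le).2 (i3 s t hs hst ht)
      rw [intervalIntegral.integral_sub (j1.add j2) j3, intervalIntegral.integral_add j1 j2]
      linarith [h ζ hζ s t hs hst ht]
  -- Density is taken within `unitBounded Ω` itself, since the inequality is available only there.
  have : Nonempty (unitBounded Ω) := ⟨⟨0, zero_mem_unitBounded⟩⟩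
  let D := TopologicalSpace.denseSeq (unitBounded Ω)
  have hD : DenseRange D := TopologicalSpace.denseRange_denseSeq _
  have hall : ∀ᵐ t ∂(volume.restrict (Ioo 0 T)), ∀ n,
      u' t (D n : W0 Ω) + ∫ x in Ω, ⟪F (t, x), (D n : W0 Ω).grad x⟫_ℝ ≤
        ∫ x in Ω, k (t, x) * (D n : W0 Ω).fn x :=
    ae_all_iff.2 fun n => hone _ (D n).2
  have hFt : ∀ᵐ t ∂(volume.restrict (Ioo 0 T)), MemLp (fun x => F (t, x)) 2 (volume.restrict Ω) :=
    ae_restrict_Ioo_of_forall_Ioo_subset fun a b h1 h2 h3 => (hF a b h1 h2 h3).ae_memLp_two_section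
  filter_upwards [hall, hFt, hk.prod_right_ae] with t h1 h2 h3 ζ hζ
  have c1 : Continuous fun ζ : unitBounded Ω => u' t (ζ : W0 Ω) :=
    (u' t).continuous.comp continuous_subtype_val
  have c2 : Continuous fun ζ : unitBounded Ω => ∫ x in Ω, ⟪F (t, x), (ζ : W0 Ω).grad x⟫_ℝ := by
    have : Continuous fun ζ : unitBounded Ω => ⟪h2.toLp _, (ζ : W0 Ω).grad⟫_ℝ :=
      continuous_const.inner ((W0.gradL Ω).continuous.comp continuous_subtype_val)
    refine this.congr fun ζ => ?_
    rw [L2.inner_def]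
    refine integral_congr_ae ?_
    filter_upwards [h2.coeFn_toLp] with x hx
    rw [hx]
  -- The source is only L¹, so L² convergence of ζ alone would not suffice; the uniform bound 1
  -- permits dominated convergence.
  have c3 : Continuous fun ζ : unitBounded Ω => ∫ x in Ω, k (t, x) * (ζ : W0 Ω).fn x := by
    rw [continuous_iff_seqContinuous]
    intro ζ η hζ
    refine tendsto_integral_mul_of_bounded h3 (C := 1) ?_ fun n => ae_abs_fn_le_one (ζ n).2
    exact (((W0.fnL Ω).continuous.comp continuous_subtype_val).tendsto η).comp hζ
  exact hD.induction_on (p := fun ζ : unitBounded Ω =>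
    u' t (ζ : W0 Ω) + ∫ x in Ω, ⟪F (t, x), (ζ : W0 Ω).grad x⟫_ℝ ≤
      ∫ x in Ω, k (t, x) * (ζ : W0 Ω).fn x) ⟨ζ, hζ⟩ (isClosed_le (c1.add c2) c3) h1

end DriftParabolic

/-! ### Smooth approximations of the Heaviside function -/

/-- `H` is a smooth nondecreasing approximation, at scale `ε`, of the Heaviside function, and `Θ`
is its primitive. -/
structure IsHeavisideApprox (L ε : ℝ) (H Θ : ℝ → ℝ) : Prop where
  contDiff : ContDiff ℝ ∞ H
  nonneg : ∀ s, 0 ≤ H s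
  le_one : ∀ s, H s ≤ 1
  eq_zero : ∀ s ≤ 0, H s = 0
  eq_one : ∀ s, ε ≤ s → H s = 1
  deriv_nonneg : ∀ s, 0 ≤ deriv H s
  deriv_le : ∀ s, deriv H s ≤ L / ε
  deriv_mul_sq_le : ∀ s, deriv H s * s ^ 2 ≤ L * ε
  primitive_sub_le : ∀ x y, Θ y - Θ x ≤ H y * (y - x)
  primitive_lipschitz : ∀ x y, |Θ x - Θ y| ≤ |x - y|
  primitive_zero : Θ 0 = 0
  abs_primitive_sub_le : ∀ s, |Θ s - max s 0| ≤ ε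

theorem exists_deriv_smoothTransition_le : ∃ L : ℝ, 0 ≤ L ∧ ∀ s, deriv Real.smoothTransition s ≤ L := by
  have hc : Continuous (deriv Real.smoothTransition) :=
    ContDiff.continuous_deriv_of_infty (Real.smoothTransition.contDiff (n := ⊤))
  obtain ⟨C, hC⟩ := isCompact_Icc.exists_bound_of_continuousOn (s := Icc (0 : ℝ) 1) hc.continuousOn
  have hC0 : 0 ≤ C := (norm_nonneg _).trans (hC 0 ⟨le_rfl, zero_le_one⟩)
  refine ⟨C, hC0, fun s => ?_⟩
  by_cases hs : s ∈ Icc (0 : ℝ) 1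
  · exact (le_abs_self _).trans (hC s hs)
  · have : deriv Real.smoothTransition s = 0 := by
      rw [mem_Icc, not_and_or, not_le, not_le] at hs
      rcases hs with hs | hs
      · have : Real.smoothTransition =ᶠ[𝓝 s] fun _ => 0 := by
          filter_upwards [Iio_mem_nhds hs] with x hx using Real.smoothTransition.zero_of_nonpos hx.le
        rw [this.deriv_eq, deriv_const]
      · have : Real.smoothTransition =ᶠ[𝓝 s] fun _ => 1 := by
          filter_upwards [Ioi_mem_nhds hs] with x hx using Real.smoothTransition.one_of_one_le hx.le
        rw [this.deriv_eq, deriv_const]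
    rw [this]
    exact hC0

/-- All scales come from rescaling one fixed transition function, which is why L does not depend on
ε. -/
theorem exists_isHeavisideApprox :
    ∃ L : ℝ, 0 ≤ L ∧ ∀ ε > 0, ∃ H Θ : ℝ → ℝ, IsHeavisideApprox L ε H Θ := by
  obtain ⟨L, hL0, hL⟩ := exists_deriv_smoothTransition_le
  refine ⟨L, hL0, fun ε hε => ?_⟩
  let H : ℝ → ℝ := fun s => Real.smoothTransition (s / ε)
  have hH : ContDiff ℝ ∞ H :=
    (Real.smoothTransition.contDiff (n := ⊤)).comp (contDiff_id.div_const ε)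
  have h0 : ∀ s, 0 ≤ H s := fun s => Real.smoothTransition.nonneg _
  have h1 : ∀ s, H s ≤ 1 := fun s => Real.smoothTransition.le_one _
  have hz : ∀ s ≤ 0, H s = 0 := fun s hs =>
    Real.smoothTransition.zero_of_nonpos (div_nonpos_of_nonpos_of_nonneg hs hε.le)
  have ho : ∀ s, ε ≤ s → H s = 1 := fun s hs =>
    Real.smoothTransition.one_of_one_le ((one_le_div hε).2 hs)
  have hmono : Monotone H := fun x y hxy =>
    Real.smoothTransition.monotone (div_le_div_of_nonneg_right hxy hε.le)
  have hd0 : ∀ s, 0 ≤ deriv H s := fun s => hmono.deriv_nonneg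
  have hd1 : ∀ s, deriv H s ≤ L / ε := by
    intro s
    have e : HasDerivAt H (deriv Real.smoothTransition (s / ε) * (1 / ε)) s :=
      HasDerivAt.comp (h₂ := Real.smoothTransition) s (((Real.smoothTransition.contDiff (n := ⊤)).differentiable
        (by simp) (s / ε)).hasDerivAt) ((hasDerivAt_id s).div_const ε)
    rw [e.deriv, mul_one_div]
    exact div_le_div_of_nonneg_right (hL _) hε.le
  -- On [0, ε] the factor s² ≤ ε² beats H' ≤ L/ε, and elsewhere H' = 0. This gain of ε makes the
  -- drift disappear in the limit.
  have hd2 : ∀ s, deriv H s * s ^ 2 ≤ L * ε := by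
    intro s
    by_cases hs : s ∈ Icc 0 ε
    · have h2 : s ^ 2 ≤ ε ^ 2 := pow_le_pow_left₀ hs.1 hs.2 2
      calc deriv H s * s ^ 2 ≤ L / ε * ε ^ 2 :=
            mul_le_mul (hd1 s) h2 (sq_nonneg s) (div_nonneg hL0 hε.le)
        _ = L * ε := by field_simp
    · have : deriv H s = 0 := by
        rw [mem_Icc, not_and_or, not_le, not_le] at hs
        rcases hs with hs | hs
        · have : H =ᶠ[𝓝 s] fun _ => 0 := by
            filter_upwards [Iio_mem_nhds hs] with x hx using hz x hx.le
          rw [this.deriv_eq, deriv_const]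
        · have : H =ᶠ[𝓝 s] fun _ => 1 := by
            filter_upwards [Ioi_mem_nhds hs] with x hx using ho x hx.le
          rw [this.deriv_eq, deriv_const]
      rw [this, zero_mul]
      positivity
  let Θ : ℝ → ℝ := fun s => ∫ r in (0 : ℝ)..s, H r
  have hi : ∀ a b, IntervalIntegrable H volume a b := fun a b => hH.continuous.intervalIntegrable a b
  have hsub : ∀ x y, Θ y - Θ x = ∫ r in x..y, H r := fun x y =>
    intervalIntegral.integral_interval_sub_left (hi 0 y) (hi 0 x)
  have hconst : ∀ c a b : ℝ, ∫ _ in a..b, c = c * (b - a) := fun c a b => by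
    rw [intervalIntegral.integral_const, smul_eq_mul, mul_comm]
  have hpl : ∀ x y, x ≤ y → 0 ≤ Θ y - Θ x ∧ Θ y - Θ x ≤ y - x := by
    intro x y hxy
    rw [hsub]
    refine ⟨intervalIntegral.integral_nonneg hxy fun r _ => h0 r, ?_⟩
    have := intervalIntegral.integral_mono_on hxy (hi x y) (intervalIntegrable_const (c := (1 : ℝ)))
      fun r _ => h1 r
    rwa [hconst, one_mul] at this
  refine ⟨H, Θ, hH, h0, h1, hz, ho, hd0, hd1, hd2, ?_, ?_, ?_, ?_⟩
  · intro x y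
    rcases le_total x y with hxy | hxy
    · rw [hsub]
      have := intervalIntegral.integral_mono_on hxy (hi x y) (intervalIntegrable_const (c := H y))
        fun r hr => hmono hr.2
      rwa [hconst] at this
    · have := intervalIntegral.integral_mono_on hxy (intervalIntegrable_const (c := H y)) (hi y x)
        fun r hr => hmono hr.1
      rw [hconst, ← hsub] at this
      linarith
  · intro x y
    rcases le_total x y with hxy | hxy
    · have := hpl x y hxy
      rw [abs_sub_comm, abs_of_nonneg this.1, abs_sub_comm, abs_of_nonneg (by linarith)]
      exact this.2
    · have := hpl y x hxy
      rw [abs_of_nonneg this.1, abs_of_nonneg (by linarith)]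
      exact this.2
  · exact intervalIntegral.integral_same
  · have hΘ0 : Θ 0 = 0 := intervalIntegral.integral_same
    intro s
    rcases le_total s 0 with hs | hs
    · have e : Θ s = 0 := by
        have := hsub 0 s
        rw [hΘ0, sub_zero, intervalIntegral.integral_symm] at this
        rw [this, neg_eq_zero]
        refine intervalIntegral.integral_zero_ae (Eventually.of_forall fun r hr => hz r ?_)
        rw [uIoc_of_le hs] at hr
        exact hr.2
      rw [e, max_eq_right hs]
      simpa using hε.le
    · have u1 := hpl 0 s hs
      rw [hΘ0, sub_zero, sub_zero] at u1
      rw [max_eq_left hs, abs_sub_comm, abs_of_nonneg (by linarith)]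
      rcases le_total s ε with hse | hse
      · linarith
      · have e : Θ s - Θ ε = s - ε := by
          rw [hsub, ← one_mul (s - ε), ← hconst]
          refine intervalIntegral.integral_congr fun r hr => ho r ?_
          rw [uIcc_of_le hse] at hr
          exact hr.1
        have := hpl 0 ε hε.le
        rw [hΘ0] at this
        linarith

/-! ### The power nonlinearity and the flux -/

/-- This is Bernoulli's inequality with exponent θ + 1 at the ratio b/a, multiplied by a^(θ+1). -/
theorem abs_rpow_sub_rpow_mul_le {a b θ : ℝ} (hθ : 0 ≤ θ) (hb : 0 ≤ b) (hab : b ≤ a) :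
    (a ^ θ - b ^ θ) * b ≤ θ * a ^ θ * (a - b) := by
  rcases hb.eq_or_lt with rfl | hb'
  · simpa using mul_nonneg (mul_nonneg hθ (Real.rpow_nonneg hab θ)) hab
  have ha : 0 < a := hb'.trans_le hab
  have h1 : 1 + (θ + 1) * (b / a - 1) ≤ (1 + (b / a - 1)) ^ (θ + 1) :=
    one_add_mul_self_le_rpow_one_add (by linarith [div_nonneg hb ha.le]) (by linarith)
  rw [add_sub_cancel, Real.rpow_add_one (div_pos hb' ha).ne', Real.div_rpow hb ha.le] at h1
  have h2 : 0 < a ^ θ := Real.rpow_pos_of_pos ha θ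
  have h3 := mul_le_mul_of_nonneg_left h1 (mul_pos h2 ha).le
  have e1 : a ^ θ * a * (b ^ θ / a ^ θ * (b / a)) = b ^ θ * b := by
    field_simp
  have e2 : a ^ θ * a * (1 + (θ + 1) * (b / a - 1)) = a ^ θ * (a + (θ + 1) * (b - a)) := by
    field_simp
  rw [e1, e2] at h3
  nlinarith

/-- The power nonlinearity `s ↦ |s|^θ s` is locally Lipschitz. -/
theorem abs_abs_rpow_mul_sub_le {θ : ℝ} (hθ : 0 ≤ θ) (a b : ℝ) :
    |(|a| ^ θ * a) - |b| ^ θ * b| ≤ (θ + 1) * (|a| ^ θ + |b| ^ θ) * |a - b| := by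
  wlog hab : |b| ≤ |a| generalizing a b
  · have := this b a (le_of_not_ge hab)
    rwa [abs_sub_comm, abs_sub_comm b a, add_comm (|b| ^ θ)] at this
  have hA : 0 ≤ |a| ^ θ := Real.rpow_nonneg (abs_nonneg a) θ
  have hB : 0 ≤ |b| ^ θ := Real.rpow_nonneg (abs_nonneg b) θ
  have hBA : |b| ^ θ ≤ |a| ^ θ := Real.rpow_le_rpow (abs_nonneg b) hab hθ
  -- The difference of powers is not Lipschitz near 0 when θ < 1; the factor b of smaller modulus
  -- compensates for this.
  have e : (|a| ^ θ * a) - |b| ^ θ * b = |a| ^ θ * (a - b) + (|a| ^ θ - |b| ^ θ) * b := by ring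
  have h1 := abs_rpow_sub_rpow_mul_le hθ (abs_nonneg b) hab
  have h2 : |a| - |b| ≤ |a - b| := abs_sub_abs_le_abs_sub a b
  rw [e]
  refine (abs_add_le _ _).trans ?_
  rw [abs_mul, abs_mul, abs_of_nonneg hA, abs_of_nonneg (sub_nonneg.2 hBA)]
  have h3 : θ * |a| ^ θ * (|a| - |b|) ≤ θ * |a| ^ θ * |a - b| :=
    mul_le_mul_of_nonneg_left h2 (mul_nonneg hθ hA)
  have h4 : 0 ≤ (θ + 1) * |b| ^ θ * |a - b| := by positivity
  nlinarith

/-- Young's inequality for the flux of the difference of two solutions. -/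
theorem neg_le_inner_flux {X : Type*} [NormedAddCommGroup X] [InnerProductSpace ℝ X]
    {A : X →L[ℝ] X} {α θ : ℝ} (hα : 0 < α) (hA : ∀ ξ : X, α * ‖ξ‖ ^ 2 ≤ ⟪A ξ, ξ⟫_ℝ)
    (hθ : 0 ≤ θ) (e x y : X) (a b : ℝ) {h C : ℝ} (hh : 0 ≤ h) (hC : h * (a - b) ^ 2 ≤ C) :
    -(C * ((θ + 1) ^ 2 / (4 * α))) * ((|a| ^ θ + |b| ^ θ) * ‖e‖) ^ 2 ≤
      ⟪(A x + (|a| ^ θ * a) • e) - (A y + (|b| ^ θ * b) • e), h • (x - y)⟫_ℝ := by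
  set S := |a| ^ θ + |b| ^ θ with hS
  have hS0 : 0 ≤ S :=
    add_nonneg (Real.rpow_nonneg (abs_nonneg a) θ) (Real.rpow_nonneg (abs_nonneg b) θ)
  set d := (|a| ^ θ * a) - |b| ^ θ * b with hd
  have hd' : |d| ≤ (θ + 1) * S * |a - b| := abs_abs_rpow_mul_sub_le hθ a b
  have e1 : (A x + (|a| ^ θ * a) • e) - (A y + (|b| ^ θ * b) • e) = A (x - y) + d • e := by
    rw [map_sub, hd, sub_smul]; abel
  rw [e1, inner_smul_right, inner_add_left, inner_smul_left]
  set ξ := x - y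
  have h1 := hA ξ
  have h2 : |d * ⟪e, ξ⟫_ℝ| ≤ (θ + 1) * S * |a - b| * (‖e‖ * ‖ξ‖) := by
    rw [abs_mul]
    exact mul_le_mul hd' (abs_real_inner_le_norm e ξ) (abs_nonneg _) (by positivity)
  have h3 := (abs_le.1 h2).1
  -- Completing the square in ‖ξ‖. All of the ellipticity is spent, which gives the constant
  -- (θ+1)²/(4α).
  have h4 : -((θ + 1) ^ 2 / (4 * α) * ((S * ‖e‖) ^ 2 * (a - b) ^ 2)) ≤
      α * ‖ξ‖ ^ 2 - (θ + 1) * S * |a - b| * (‖e‖ * ‖ξ‖) := by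
    rw [← sq_abs (a - b)]
    have : 0 ≤ (2 * α * ‖ξ‖ - (θ + 1) * S * |a - b| * ‖e‖) ^ 2 / (4 * α) := by positivity
    have e2 : (2 * α * ‖ξ‖ - (θ + 1) * S * |a - b| * ‖e‖) ^ 2 / (4 * α) =
        α * ‖ξ‖ ^ 2 - (θ + 1) * S * |a - b| * (‖e‖ * ‖ξ‖) +
          (θ + 1) ^ 2 / (4 * α) * ((S * ‖e‖) ^ 2 * |a - b| ^ 2) := by
      field_simp
      ring
    linarith
  have h5 : h * (α * ‖ξ‖ ^ 2 - (θ + 1) * S * |a - b| * (‖e‖ * ‖ξ‖)) ≤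
      h * (⟪A ξ, ξ⟫_ℝ + d * ⟪e, ξ⟫_ℝ) := mul_le_mul_of_nonneg_left (by linarith) hh
  have h6 := mul_le_mul_of_nonneg_left h4 hh
  have h7 : h * (a - b) ^ 2 * ((θ + 1) ^ 2 / (4 * α) * (S * ‖e‖) ^ 2) ≤
      C * ((θ + 1) ^ 2 / (4 * α) * (S * ‖e‖) ^ 2) := mul_le_mul_of_nonneg_right hC (by positivity)
  simp only [conj_trivial]
  linarith

/-! ### Integrability of the flux, and test functions constant in time -/

namespace DriftParabolic

variable {N : ℕ} {Ω : Set (Eu N)} {T : ℝ}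

theorem restrict_prod_eq (a b : ℝ) (Ω : Set (Eu N)) :
    (volume.restrict (Ioo a b)).prod (volume.restrict Ω) =
      (volume : Measure (ℝ × Eu N)).restrict (Ioo a b ×ˢ Ω) :=
  Measure.prod_restrict _ _

theorem restrict_prod_mono {a b c d : ℝ} (hac : a ≤ c) (hdb : d ≤ b) (Ω : Set (Eu N)) :
    (volume.restrict (Ioo c d)).prod (volume.restrict Ω) ≤
      ((volume : Measure ℝ).restrict (Ioo a b)).prod (volume.restrict Ω) :=
  Measure.prod_mono (Measure.restrict_mono (Ioo_subset_Ioo hac hdb) le_rfl) le_rfl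

/-- `Y` and `G` are jointly measurable representatives of `v` and of its gradient. -/
structure IsRepresentative (T : ℝ) (v : ℝ → Lp ℝ 1 (volume.restrict Ω)) (V : ℝ → W0 Ω)
    (Y : ℝ × Eu N → ℝ) (G : ℝ × Eu N → Eu N) : Prop where
  measurable_fn : StronglyMeasurable Y
  measurable_grad : StronglyMeasurable G
  fn_eq : ∀ᵐ t ∂(volume.restrict (Ioo 0 T)), ∀ᵐ x ∂(volume.restrict Ω), Y (t, x) = v t x
  grad_eq : ∀ᵐ t ∂(volume.restrict (Ioo 0 T)), ∀ᵐ x ∂(volume.restrict Ω), G (t, x) = (V t).grad x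

theorem MemCL1W2loc.exists_isRepresentative {v : ℝ → Lp ℝ 1 (volume.restrict Ω)} {V : ℝ → W0 Ω}
    {V' : ℝ → WNeg Ω} (hv : MemCL1W2loc T v V V') :
    ∃ (Y : ℝ × Eu N → ℝ) (G : ℝ × Eu N → Eu N), IsRepresentative T v V Y G := by
  have : Fact ((1 : ℝ≥0∞) ≠ ⊤) := ⟨by simp⟩
  have : Fact ((2 : ℝ≥0∞) ≠ ⊤) := ⟨by simp⟩
  have h1 : AEStronglyMeasurable v (volume.restrict (Ioo 0 T)) :=
    (hv.continuousOn.mono Ioo_subset_Icc_self).aestronglyMeasurable measurableSet_Ioo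
  have h2 : AEStronglyMeasurable (fun t => (V t).grad) (volume.restrict (Ioo 0 T)) :=
    (hv.memL2loc.clm (W0.gradL Ω)).locallyIntegrableOn.aestronglyMeasurable
  obtain ⟨Y, hY, hY'⟩ := h1.exists_uncurry_of_Lp
  obtain ⟨G, hG, hG'⟩ := h2.exists_uncurry_of_Lp
  exact ⟨Y, G, hY, hG, hY', hG'⟩

/-- The flux `M ∇v + E |v|^θ v`. -/
noncomputable def flux (M : ℝ × Eu N → (Eu N →L[ℝ] Eu N)) (E : ℝ × Eu N → Eu N) (θ : ℝ)
    (Y : ℝ × Eu N → ℝ) (G : ℝ × Eu N → Eu N) (p : ℝ × Eu N) : Eu N :=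
  M p (G p) + (|Y p| ^ θ * Y p) • E p

/-- `FiniteL2` carries no measurability; it is supplied by a jointly measurable F' with the same
slices, and Tonelli's theorem does the rest. -/
theorem FiniteL2.memLp {a b : ℝ} {F : ℝ → Eu N → ℝ} (hF : FiniteL2 Ω a b F)
    {F' : ℝ × Eu N → ℝ}
    (hm : AEStronglyMeasurable F' ((volume.restrict (Ioo a b)).prod (volume.restrict Ω)))
    (h : ∀ᵐ t ∂(volume.restrict (Ioo a b)), ∀ᵐ x ∂(volume.restrict Ω), F' (t, x) = F t x) :
    MemLp F' 2 ((volume.restrict (Ioo a b)).prod (volume.restrict Ω)) := by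
  refine ⟨hm, ?_⟩
  rw [eLpNorm_lt_top_iff_lintegral_rpow_enorm_lt_top (by simp) (by simp),
    lintegral_prod _ (hm.enorm.pow_const _)]
  refine lt_of_eq_of_lt (lintegral_congr_ae ?_) hF
  filter_upwards [h] with t ht
  refine lintegral_congr_ae ?_
  filter_upwards [ht] with x hx
  rw [hx]
  simp

/-- The diffusive part is dominated by β |∇v| and the drift by B. The majorant is left free because
the hypothesis controls the terms in v and w together. -/
theorem IsRepresentative.memLp_flux {v : ℝ → Lp ℝ 1 (volume.restrict Ω)} {V : ℝ → W0 Ω}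
    {Y : ℝ × Eu N → ℝ} {G : ℝ × Eu N → Eu N} (hr : IsRepresentative T v V Y G)
    (hV : MemL2loc T V) {M : ℝ × Eu N → (Eu N →L[ℝ] Eu N)} {E : ℝ × Eu N → Eu N} {β θ : ℝ}
    (hθ : 0 < θ)
    (hM : AEStronglyMeasurable M ((volume.restrict (Ioo 0 T)).prod (volume.restrict Ω)))
    (hMb : ∀ᵐ p ∂((volume.restrict (Ioo 0 T)).prod (volume.restrict Ω)), ‖M p‖ ≤ β)
    (hE : AEStronglyMeasurable E ((volume.restrict (Ioo 0 T)).prod (volume.restrict Ω)))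
    {a b : ℝ} (ha : 0 < a) (hab : a < b) (hb : b < T) {B : ℝ × Eu N → ℝ}
    (hB : MemLp B 2 ((volume.restrict (Ioo a b)).prod (volume.restrict Ω)))
    (hYB : ∀ p, ‖E p‖ * |Y p| ^ (θ + 1) ≤ B p) :
    MemLp (flux M E θ Y G) 2 ((volume.restrict (Ioo a b)).prod (volume.restrict Ω)) := by
  have hle := restrict_prod_mono ha.le hb.le Ω
  have hG : MemLp G 2 ((volume.restrict (Ioo a b)).prod (volume.restrict Ω)) := by
    refine memLp_two_prod_of_ae_eq ((hV.clm (W0.gradL Ω)) a b ha hab hb)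
      hr.measurable_grad.aestronglyMeasurable ?_
    exact ae_restrict_of_ae_restrict_of_subset (Ioo_subset_Ioo ha.le hb.le) hr.grad_eq
  refine MemLp.add ?_ ?_
  · refine hG.of_le_mul (c := β) ?_ ?_
    · exact (ContinuousLinearMap.id ℝ (Eu N →L[ℝ] Eu N)).aestronglyMeasurable_comp₂
        (hM.mono_measure hle) hG.1
    · filter_upwards [hMb.filter_mono (ae_mono hle)] with p hp
      exact (M p).le_of_opNorm_le hp _
  · refine hB.of_le ?_ (Eventually.of_forall fun p => ?_)
    · have h1 := hr.measurable_fn.measurable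
      have h2 : Measurable fun p => |Y p| ^ θ * Y p := by fun_prop
      exact h2.aestronglyMeasurable.smul (hE.mono_measure hle)
    · rw [norm_smul, norm_mul, Real.norm_eq_abs, Real.norm_eq_abs,
        abs_of_nonneg (Real.rpow_nonneg (abs_nonneg _) θ)]
      refine le_trans ?_ ((hYB p).trans (le_abs_self _))
      rw [Real.rpow_add_one' (abs_nonneg _) (by positivity)]
      linarith

theorem IsRepresentative.weakForm_const {v : ℝ → Lp ℝ 1 (volume.restrict Ω)} {V : ℝ → W0 Ω}
    {V' : ℝ → WNeg Ω} {Y : ℝ × Eu N → ℝ} {G : ℝ × Eu N → Eu N} (hr : IsRepresentative T v V Y G)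
    (M : ℝ × Eu N → (Eu N →L[ℝ] Eu N)) (E : ℝ × Eu N → Eu N) (θ : ℝ) (ζ : W0 Ω) {t₁ t₂ : ℝ}
    (h1 : 0 ≤ t₁) (h12 : t₁ ≤ t₂) (h2 : t₂ ≤ T) :
    weakForm M E θ v V V' (fun _ => ζ) t₁ t₂ =
      (∫ t in t₁..t₂, V' t ζ) + ∫ t in t₁..t₂, ∫ x in Ω, ⟪flux M E θ Y G (t, x), ζ.grad x⟫_ℝ := by
  rw [weakForm]
  congr 1
  rw [intervalIntegral.integral_of_le h12, intervalIntegral.integral_of_le h12,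
    integral_Ioc_eq_integral_Ioo, integral_Ioc_eq_integral_Ioo]
  refine integral_congr_ae ?_
  filter_upwards [ae_restrict_of_ae_restrict_of_subset (Ioo_subset_Ioo h1 h2) hr.fn_eq,
    ae_restrict_of_ae_restrict_of_subset (Ioo_subset_Ioo h1 h2) hr.grad_eq] with t e1 e2
  refine integral_congr_ae ?_
  filter_upwards [e1, e2] with x k1 k2
  rw [flux, k1, k2, inner_add_left]

theorem hasWeakTimeDeriv_const (hT : 0 < T) (ζ : W0 Ω) :
    HasWeakTimeDeriv T (fun _ => ζ) (fun _ => (0 : WNeg Ω)) := by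
  intro η ψ h1 h2 h3
  have e0 : ∀ t, t ∉ Ioo 0 T → ψ t = 0 := fun t ht =>
    image_eq_zero_of_notMem_tsupport fun h => ht (h3 h)
  have : ∫ t in Ioo 0 T, deriv ψ t = 0 := by
    rw [← integral_Ioc_eq_integral_Ioo, ← intervalIntegral.integral_of_le hT.le,
      intervalIntegral.integral_deriv_eq_sub
        (fun t _ => h1.differentiable (by simp) t)
        (h1.continuous_deriv_of_infty.intervalIntegrable _ _),
      e0 T (by simp), e0 0 (by simp), sub_zero]
  rw [integral_mul_const, this]
  simp

theorem memW2_const (hT : 0 < T) (ζ : W0 Ω) : MemW2 T (fun _ => ζ) :=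
  ⟨memLp_const ζ, fun _ => 0, memLp_const 0, hasWeakTimeDeriv_const hT ζ⟩

theorem memLInfty_const {ζ : W0 Ω} (hζ : ζ ∈ unitBounded Ω) : MemLInfty T (fun _ => ζ) :=
  ⟨1, Eventually.of_forall fun _ => ae_abs_fn_le_one hζ⟩

theorem isNonneg_const {ζ : W0 Ω} (hζ : ζ ∈ unitBounded Ω) : IsNonneg T (fun _ => ζ) :=
  Eventually.of_forall fun _ => by filter_upwards [hζ] with x hx using hx.1

end DriftParabolic

/-! ### Testing with the approximate Heaviside function -/

namespace DriftParabolic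

variable {N : ℕ} {Ω : Set (Eu N)} {T : ℝ} {z : ℝ → Lp ℝ 1 (volume.restrict Ω)} {u : ℝ → W0 Ω}
  {u' : ℝ → WNeg Ω} {F G : ℝ × Eu N → Eu N} {k Y B : ℝ × Eu N → ℝ} {a b c : ℝ}

/-- The estimate obtained by testing with a smooth approximation of the Heaviside function. -/
theorem integral_primitive_sub_le (hz : ContinuousOn z (Icc 0 T))
    (hzu : ∀ᵐ t ∂(volume.restrict (Ioo 0 T)), ∀ᵐ x ∂(volume.restrict Ω), (u t).fn x = z t x)
    (hu : MemL2loc T u) (hu' : MemL2loc T u') (hd : HasWeakTimeDeriv T u u')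
    (hY : StronglyMeasurable Y)
    (hYz : ∀ᵐ t ∂(volume.restrict (Ioo 0 T)), ∀ᵐ x ∂(volume.restrict Ω), Y (t, x) = z t x)
    (hGu : ∀ᵐ t ∂(volume.restrict (Ioo 0 T)), ∀ᵐ x ∂(volume.restrict Ω), G (t, x) = (u t).grad x)
    (ha : 0 < a) (hab : a < b) (hb : b < T)
    (hF : MemLp F 2 ((volume.restrict (Ioo a b)).prod (volume.restrict Ω)))
    (hk : Integrable k ((volume.restrict (Ioo a b)).prod (volume.restrict Ω)))
    (hB : MemLp B 2 ((volume.restrict (Ioo a b)).prod (volume.restrict Ω)))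
    (hineq : ∀ᵐ t ∂(volume.restrict (Ioo 0 T)), ∀ ζ ∈ unitBounded Ω,
      u' t ζ + ∫ x in Ω, ⟪F (t, x), ζ.grad x⟫_ℝ ≤ ∫ x in Ω, k (t, x) * ζ.fn x)
    (hflux : ∀ᵐ p ∂((volume.restrict (Ioo a b)).prod (volume.restrict Ω)), ∀ h C : ℝ,
      0 ≤ h → h * Y p ^ 2 ≤ C → -(C * c) * B p ^ 2 ≤ ⟪F p, h • G p⟫_ℝ)
    {L ε : ℝ} (hL : 0 ≤ L) (hε : 0 < ε) {H Θ : ℝ → ℝ} (hH : IsHeavisideApprox L ε H Θ) :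
    (∫ x in Ω, Θ (z b x)) - ∫ x in Ω, Θ (z a x) ≤
      (∫ p, k p * H (Y p) ∂((volume.restrict (Ioo a b)).prod (volume.restrict Ω))) +
        L * ε * c * ∫ p, B p ^ 2 ∂((volume.restrict (Ioo a b)).prod (volume.restrict Ω)) := by
  have hsub := Ioo_subset_Ioo ha.le hb.le
  let K : NNReal := ⟨L / ε, div_nonneg hL hε.le⟩
  have hK : ∀ s, |deriv H s| ≤ K := fun s => by
    rw [abs_of_nonneg (hH.deriv_nonneg s)]
    exact hH.deriv_le s
  have hH0 : H 0 = 0 := hH.eq_zero 0 le_rfl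
  let φ : ℝ → W0 Ω := fun t => (u t).comp hH.contDiff hK hH0
  have hφ : MemL2 a b φ := by
    have huab : MemLp u 2 (volume.restrict (Ioo a b)) := hu a b ha hab hb
    exact huab.of_le_mul (c := K)
      ((W0.continuous_comp hH.contDiff hK hH0).comp_aestronglyMeasurable huab.1)
      (Eventually.of_forall fun t => W0.norm_comp_le hH.contDiff hK hH0 (u t))
  have hφ1 : ∀ t, φ t ∈ unitBounded Ω := fun t => by
    filter_upwards [(u t).coeFn_comp hH.contDiff hK hH0] with x hx
    rw [hx]
    exact ⟨hH.nonneg _, hH.le_one _⟩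
  refine (integral_comp_sub_le_integral_pairing hz hzu hu hu' hd hH.primitive_sub_le
    hH.primitive_lipschitz hH.primitive_zero ha hab hb hφ (Eventually.of_forall fun t =>
      (u t).coeFn_comp hH.contDiff hK hH0)).trans ?_
  have hHm : Measurable H := hH.contDiff.continuous.measurable
  have hkH : Integrable (fun p => k p * H (Y p))
      ((volume.restrict (Ioo a b)).prod (volume.restrict Ω)) := by
    refine hk.mul_bdd (c := 1) (hHm.comp hY.measurable).aestronglyMeasurable
      (Eventually.of_forall fun p => ?_)
    rw [Real.norm_of_nonneg (hH.nonneg _)]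
    exact hH.le_one _
  have hB2 : Integrable (fun p => B p ^ 2)
      ((volume.restrict (Ioo a b)).prod (volume.restrict Ω)) := hB.integrable_sq
  rw [integral_prod _ hkH, integral_prod _ hB2, ← integral_const_mul,
    ← integral_add hkH.integral_prod_left (hB2.integral_prod_left.const_mul _),
    intervalIntegral.integral_of_le hab.le, integral_Ioc_eq_integral_Ioo]
  refine integral_mono_ae ((hu' a b ha hab hb).integrable_pairing hφ)
    (hkH.integral_prod_left.add (hB2.integral_prod_left.const_mul _)) ?_
  filter_upwards [ae_restrict_of_ae_restrict_of_subset hsub hineq,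
    ae_restrict_of_ae_restrict_of_subset hsub hYz, ae_restrict_of_ae_restrict_of_subset hsub hzu,
    ae_restrict_of_ae_restrict_of_subset hsub hGu, hF.ae_memLp_two_section,
    hB2.prod_right_ae, Measure.ae_ae_of_ae_prod hflux] with t h1 h2 h3 h4 h5 h6 h7
  -- A test function chosen after t is legitimate, since the exceptional null set does not depend on
  -- ζ.
  have e1 := h1 (φ t) (hφ1 t)
  have e2 : ∫ x in Ω, k (t, x) * (φ t).fn x = ∫ x in Ω, k (t, x) * H (Y (t, x)) := by
    refine integral_congr_ae ?_
    filter_upwards [h2, h3, (u t).coeFn_comp hH.contDiff hK hH0] with x j1 j2 j3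
    rw [j3, j2, j1]
  have e3 : -(L * ε * c) * ∫ x in Ω, B (t, x) ^ 2 ≤ ∫ x in Ω, ⟪F (t, x), (φ t).grad x⟫_ℝ := by
    rw [← integral_const_mul]
    refine integral_mono_ae (h6.const_mul _)
      (h5.integrable_inner_two (Lp.memLp (φ t).grad)) ?_
    filter_upwards [h2, h3, h4, h7, (u t).coeFn_grad_comp hH.contDiff hK hH0] with x j1 j2 j3 j4 j5
    rw [j5, ← j3, j2, ← j1]
    -- The flux bound is used at each point with h = H'(Y) and C = Lε.
    exact j4 _ _ (hH.deriv_nonneg _) (hH.deriv_mul_sq_le _)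
  rw [e2] at e1
  linarith

/-- The estimate for the positive part, away from the initial and final times. -/
theorem integral_posPart_sub_le (hΩb : Bornology.IsBounded Ω) (hz : ContinuousOn z (Icc 0 T))
    (hzu : ∀ᵐ t ∂(volume.restrict (Ioo 0 T)), ∀ᵐ x ∂(volume.restrict Ω), (u t).fn x = z t x)
    (hu : MemL2loc T u) (hu' : MemL2loc T u') (hd : HasWeakTimeDeriv T u u')
    (hY : StronglyMeasurable Y)
    (hYz : ∀ᵐ t ∂(volume.restrict (Ioo 0 T)), ∀ᵐ x ∂(volume.restrict Ω), Y (t, x) = z t x)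
    (hGu : ∀ᵐ t ∂(volume.restrict (Ioo 0 T)), ∀ᵐ x ∂(volume.restrict Ω), G (t, x) = (u t).grad x)
    (ha : 0 < a) (hab : a < b) (hb : b < T)
    (hF : MemLp F 2 ((volume.restrict (Ioo a b)).prod (volume.restrict Ω)))
    (hk : Integrable k ((volume.restrict (Ioo a b)).prod (volume.restrict Ω)))
    (hB : MemLp B 2 ((volume.restrict (Ioo a b)).prod (volume.restrict Ω)))
    (hineq : ∀ᵐ t ∂(volume.restrict (Ioo 0 T)), ∀ ζ ∈ unitBounded Ω,
      u' t ζ + ∫ x in Ω, ⟪F (t, x), ζ.grad x⟫_ℝ ≤ ∫ x in Ω, k (t, x) * ζ.fn x)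
    (hflux : ∀ᵐ p ∂((volume.restrict (Ioo a b)).prod (volume.restrict Ω)), ∀ h C : ℝ,
      0 ≤ h → h * Y p ^ 2 ≤ C → -(C * c) * B p ^ 2 ≤ ⟪F p, h • G p⟫_ℝ) :
    (∫ x in Ω, max (z b x) 0) - ∫ x in Ω, max (z a x) 0 ≤
      ∫ p, {q | 0 < Y q}.indicator k p
        ∂((volume.restrict (Ioo a b)).prod (volume.restrict Ω)) := by
  obtain ⟨L, hL, hHΘ⟩ := exists_isHeavisideApprox
  have hεpos : ∀ n : ℕ, (0 : ℝ) < 1 / ((n : ℝ) + 1) := fun n => Nat.one_div_pos_of_nat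
  choose H Θ hH using fun n : ℕ => hHΘ (1 / ((n : ℝ) + 1)) (hεpos n)
  -- Boundedness of Ω turns the uniform bound |Θ(s) - s₊| ≤ ε into convergence of the integrals.
  have : IsFiniteMeasure (volume.restrict Ω) := ⟨by simpa using hΩb.measure_lt_top⟩
  have limε : Tendsto (fun n : ℕ => 1 / ((n : ℝ) + 1)) atTop (𝓝 0) :=
    tendsto_one_div_add_atTop_nhds_zero_nat
  have hmax : ∀ t, Integrable (fun x => max (z t x) 0) (volume.restrict Ω) := fun t =>
    (L1.integrable_coeFn (z t)).pos_part
  have limΘ : ∀ t, Tendsto (fun n => ∫ x in Ω, Θ n (z t x)) atTop (𝓝 (∫ x in Ω, max (z t x) 0)) := by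
    intro t
    rw [tendsto_iff_norm_sub_tendsto_zero]
    refine squeeze_zero (fun _ => norm_nonneg _)
      (g := fun n : ℕ => 1 / ((n : ℝ) + 1) * (volume.restrict Ω).real univ) (fun n => ?_)
      (by simpa using limε.mul_const ((volume.restrict Ω).real univ))
    rw [← integral_sub (integrable_comp_of_abs_sub_le (hH n).primitive_lipschitz
      (hH n).primitive_zero (L1.integrable_coeFn (z t))) (hmax t)]
    exact norm_integral_le_of_norm_le_const (Eventually.of_forall fun x =>
      (hH n).abs_primitive_sub_le _)
  have limk : Tendsto
      (fun n => ∫ p, k p * H n (Y p) ∂((volume.restrict (Ioo a b)).prod (volume.restrict Ω)))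
      atTop (𝓝 (∫ p, {q | 0 < Y q}.indicator k p
        ∂((volume.restrict (Ioo a b)).prod (volume.restrict Ω)))) := by
    refine tendsto_integral_of_dominated_convergence (fun p => ‖k p‖) (fun n => ?_) hk.norm
      (fun n => Eventually.of_forall fun p => ?_) (Eventually.of_forall fun p => ?_)
    · exact hk.1.mul ((hH n).contDiff.continuous.measurable.comp
        hY.measurable).aestronglyMeasurable
    · rw [norm_mul, Real.norm_of_nonneg ((hH n).nonneg _)]
      exact mul_le_of_le_one_right (norm_nonneg _) ((hH n).le_one _)
    -- H vanishes at 0 for every ε, so the limit is the indicator of the strict inequality.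
    · by_cases hp : 0 < Y p
      · rw [indicator_of_mem (show p ∈ {q | 0 < Y q} from hp)]
        refine tendsto_const_nhds.congr' ?_
        filter_upwards [limε.eventually (gt_mem_nhds hp)] with n hn
        rw [(hH n).eq_one _ (le_of_lt hn), mul_one]
      · rw [indicator_of_notMem (show p ∉ {q | 0 < Y q} from hp)]
        refine tendsto_const_nhds.congr fun n => ?_
        rw [(hH n).eq_zero _ (not_lt.1 hp), mul_zero]
  have limB : Tendsto (fun n : ℕ => L * (1 / ((n : ℝ) + 1)) * c *
      ∫ p, B p ^ 2 ∂((volume.restrict (Ioo a b)).prod (volume.restrict Ω))) atTop (𝓝 0) := by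
    have := ((limε.const_mul L).mul_const c).mul_const
      (∫ p, B p ^ 2 ∂((volume.restrict (Ioo a b)).prod (volume.restrict Ω)))
    simpa using this
  have lim := limk.add limB
  rw [add_zero] at lim
  exact le_of_tendsto_of_tendsto' ((limΘ b).sub (limΘ a)) lim fun n =>
    integral_primitive_sub_le hz hzu hu hu' hd hY hYz hGu ha hab hb hF hk hB hineq hflux hL
      (hεpos n) (hH n)

end DriftParabolic

/-! ### The contraction estimate and uniqueness -/

namespace DriftParabolic

variable {N : ℕ} {Ω : Set (Eu N)} {T : ℝ}

/-- Subtracting the two weak formulations, tested with a function constant in time. -/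
theorem sub_weakForm_const_le (hT : 0 < T) {M : ℝ × Eu N → (Eu N →L[ℝ] Eu N)}
    {E : ℝ × Eu N → Eu N} {θ : ℝ} {f g : ℝ × Eu N → ℝ}
    (hf : Integrable f ((volume.restrict (Ioo 0 T)).prod (volume.restrict Ω)))
    (hg : Integrable g ((volume.restrict (Ioo 0 T)).prod (volume.restrict Ω)))
    {v w : ℝ → Lp ℝ 1 (volume.restrict Ω)} {V W : ℝ → W0 Ω} {V' W' : ℝ → WNeg Ω}
    {Yv Yw : ℝ × Eu N → ℝ} {Gv Gw : ℝ × Eu N → Eu N}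
    (hrv : IsRepresentative T v V Yv Gv) (hrw : IsRepresentative T w W Yw Gw)
    (hV' : MemL2loc T V') (hW' : MemL2loc T W')
    (hFv : ∀ a b, 0 < a → a < b → b < T →
      MemLp (flux M E θ Yv Gv) 2 ((volume.restrict (Ioo a b)).prod (volume.restrict Ω)))
    (hFw : ∀ a b, 0 < a → a < b → b < T →
      MemLp (flux M E θ Yw Gw) 2 ((volume.restrict (Ioo a b)).prod (volume.restrict Ω)))
    (hvsub : IsSubsolution T M E θ f v V V') (hwsup : IsSupersolution T M E θ g w W W')
    {ζ : W0 Ω} (hζ : ζ ∈ unitBounded Ω) {t₁ t₂ : ℝ} (h1 : 0 < t₁) (h12 : t₁ < t₂) (h2 : t₂ < T) :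
    (∫ t in t₁..t₂, (V' t - W' t) ζ) + (∫ t in t₁..t₂, ∫ x in Ω,
        ⟪flux M E θ Yv Gv (t, x) - flux M E θ Yw Gw (t, x), ζ.grad x⟫_ℝ) ≤
      ∫ t in t₁..t₂, ∫ x in Ω, (f (t, x) - g (t, x)) * ζ.fn x := by
  have hv := hvsub t₁ t₂ h1 h12 h2 _ (memW2_const hT ζ) (memLInfty_const hζ) (isNonneg_const hζ)
  have hw := hwsup t₁ t₂ h1 h12 h2 _ (memW2_const hT ζ) (memLInfty_const hζ) (isNonneg_const hζ)
  rw [hrv.weakForm_const M E θ ζ h1.le h12.le h2.le] at hv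
  rw [hrw.weakForm_const M E θ ζ h1.le h12.le h2.le] at hw
  have hle := restrict_prod_mono h1.le h2.le Ω
  have ii : ∀ {r : ℝ → ℝ}, Integrable r (volume.restrict (Ioo t₁ t₂)) →
      IntervalIntegrable r volume t₁ t₂ := fun h =>
    (intervalIntegrable_iff_integrableOn_Ioo_of_le h12.le).2 h
  have icongr : ∀ {r s : ℝ → ℝ}, r =ᵐ[volume.restrict (Ioo t₁ t₂)] s →
      ∫ t in t₁..t₂, r t = ∫ t in t₁..t₂, s t := fun h => by
    rw [intervalIntegral.integral_of_le h12.le, intervalIntegral.integral_of_le h12.le,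
      integral_Ioc_eq_integral_Ioo, integral_Ioc_eq_integral_Ioo, integral_congr_ae h]
  have e1 : ∫ t in t₁..t₂, (V' t - W' t) ζ = (∫ t in t₁..t₂, V' t ζ) - ∫ t in t₁..t₂, W' t ζ := by
    simp only [sub_apply]
    have kv : Integrable (fun t => V' t ζ) (volume.restrict (Ioo t₁ t₂)) :=
      ((hV'.apply ζ) _ _ h1 h12 h2).integrableOn
    have kw : Integrable (fun t => W' t ζ) (volume.restrict (Ioo t₁ t₂)) :=
      ((hW'.apply ζ) _ _ h1 h12 h2).integrableOn
    exact intervalIntegral.integral_sub (ii kv) (ii kw)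
  have jv := integrable_inner_grad (hFv _ _ h1 h12 h2) ζ
  have jw := integrable_inner_grad (hFw _ _ h1 h12 h2) ζ
  have e2 : (∫ t in t₁..t₂, ∫ x in Ω,
      ⟪flux M E θ Yv Gv (t, x) - flux M E θ Yw Gw (t, x), ζ.grad x⟫_ℝ) =
      (∫ t in t₁..t₂, ∫ x in Ω, ⟪flux M E θ Yv Gv (t, x), ζ.grad x⟫_ℝ) -
        ∫ t in t₁..t₂, ∫ x in Ω, ⟪flux M E θ Yw Gw (t, x), ζ.grad x⟫_ℝ := by
    rw [← intervalIntegral.integral_sub (ii jv.integral_prod_left) (ii jw.integral_prod_left)]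
    refine icongr ?_
    filter_upwards [jv.prod_right_ae, jw.prod_right_ae] with t k1 k2
    rw [← integral_sub k1 k2]
    simp only [inner_sub_left]
  have jf := integrable_mul_fn (hf.mono_measure hle) hζ
  have jg := integrable_mul_fn (hg.mono_measure hle) hζ
  have e3 : (∫ t in t₁..t₂, ∫ x in Ω, (f (t, x) - g (t, x)) * ζ.fn x) =
      (∫ t in t₁..t₂, ∫ x in Ω, f (t, x) * ζ.fn x) -
        ∫ t in t₁..t₂, ∫ x in Ω, g (t, x) * ζ.fn x := by
    rw [← intervalIntegral.integral_sub (ii jf.integral_prod_left) (ii jg.integral_prod_left)]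
    refine icongr ?_
    filter_upwards [jf.prod_right_ae, jg.prod_right_ae] with t k1 k2
    rw [← integral_sub k1 k2]
    simp only [sub_mul]
  rw [e1, e2, e3]
  linarith

/-- An integral inequality between interior times extends to the closed interval. -/
theorem le_integral_add_of_forall_Ioo {T : ℝ} (hT : 0 < T) {P κ : ℝ → ℝ}
    (hP : ContinuousOn P (Icc 0 T)) (hκ : IntervalIntegrable κ volume 0 T)
    (h : ∀ a b, 0 < a → a < b → b < T → P b - P a ≤ ∫ t in a..b, κ t)
    {τ : ℝ} (hτ : τ ∈ Icc (0 : ℝ) T) : P τ ≤ (∫ t in (0 : ℝ)..τ, κ t) + P 0 := by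
  rcases hτ.1.eq_or_lt with rfl | hτ0
  · simp
  -- R is nonincreasing on (0,T) and continuous on [0,T]; the later time is sent to τ first, then
  -- the earlier one to 0.
  let R : ℝ → ℝ := fun t => P t - ∫ s in (0 : ℝ)..t, κ s
  have hR : ContinuousOn R (Icc 0 T) := by
    refine hP.sub ?_
    have := intervalIntegral.continuousOn_primitive_interval
      ((intervalIntegrable_iff' (by simp)).1 hκ)
    rwa [uIcc_of_le hT.le] at this
  have hRanti : ∀ a b, 0 < a → a < b → b < T → R b ≤ R a := by
    intro a b ha hab hb
    have i : ∀ s ∈ Icc 0 T, IntervalIntegrable κ volume 0 s := fun s hs =>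
      hκ.mono_set (by rw [uIcc_of_le hT.le, uIcc_of_le hs.1]; exact Icc_subset_Icc_right hs.2)
    have := intervalIntegral.integral_interval_sub_left
      (i b ⟨by linarith, hb.le⟩) (i a ⟨ha.le, by linarith⟩)
    have := h a b ha hab hb
    simp only [R]
    linarith
  have hR0 : R 0 = P 0 := by simp [R]
  have hτT : Icc 0 τ ⊆ Icc 0 T := Icc_subset_Icc_right hτ.2
  have hmid : ∀ a, 0 < a → a < τ → R τ ≤ R a := by
    intro a ha haτ
    have ht : Tendsto R (𝓝[Ioo a τ] τ) (𝓝 (R τ)) :=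
      (hR τ hτ).mono_left (nhdsWithin_mono _ fun s hs =>
        ⟨by linarith [hs.1], by linarith [hs.2, hτ.2]⟩)
    have : (𝓝[Ioo a τ] τ).NeBot := right_nhdsWithin_Ioo_neBot haτ
    refine le_of_tendsto ht ?_
    filter_upwards [self_mem_nhdsWithin] with s hs
    exact hRanti a s ha hs.1 (by linarith [hs.2, hτ.2])
  have hfin : R τ ≤ R 0 := by
    have ht : Tendsto R (𝓝[Ioo 0 τ] 0) (𝓝 (R 0)) :=
      (hR 0 ⟨le_rfl, hT.le⟩).mono_left (nhdsWithin_mono _ fun s hs =>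
        ⟨hs.1.le, by linarith [hs.2, hτ.2]⟩)
    have : (𝓝[Ioo 0 τ] (0 : ℝ)).NeBot := left_nhdsWithin_Ioo_neBot hτ0
    refine ge_of_tendsto ht ?_
    filter_upwards [self_mem_nhdsWithin] with s hs
    exact hmid s hs.1 hs.2
  rw [hR0] at hfin
  simp only [R] at hfin
  linarith

/-- The `L¹` contraction estimate. -/
theorem integral_posPart_le (hΩb : Bornology.IsBounded Ω) (hT : 0 < T)
    {M : ℝ × Eu N → (Eu N →L[ℝ] Eu N)} {α β : ℝ} (hα : 0 < α)
    (hM : AEStronglyMeasurable M (volume.restrict (spaceTime Ω T)))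
    (hMell : ∀ᵐ p ∂(volume.restrict (spaceTime Ω T)),
      (∀ ξ : Eu N, α * ‖ξ‖ ^ 2 ≤ ⟪M p ξ, ξ⟫_ℝ) ∧ ‖M p‖ ≤ β)
    {θ : ℝ} (hθ : 0 < θ) {f g : ℝ × Eu N → ℝ} (hf : IntegrableOn f (spaceTime Ω T))
    (hg : IntegrableOn g (spaceTime Ω T))
    {E : ℝ × Eu N → Eu N} (hE : MemLp E 2 (volume.restrict (spaceTime Ω T)))
    {v w : ℝ → Lp ℝ 1 (volume.restrict Ω)} {V W : ℝ → W0 Ω} {V' W' : ℝ → WNeg Ω}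
    (hv : MemCL1W2loc T v V V') (hw : MemCL1W2loc T w W W')
    (hloc : ∀ a b : ℝ, 0 < a → a < b → b < T →
      FiniteL2 Ω a b (fun t x => ‖E (t, x)‖ * (|v t x| ^ (θ + 1) + |w t x| ^ (θ + 1))))
    (hvsub : IsSubsolution T M E θ f v V V') (hwsup : IsSupersolution T M E θ g w W W')
    (hglob : FiniteL2 Ω 0 T (fun t x => (|v t x| ^ θ + |w t x| ^ θ) * ‖E (t, x)‖))
    {τ : ℝ} (hτ : τ ∈ Icc (0 : ℝ) T) :
    ∫ x in Ω, max (v τ x - w τ x) 0 ≤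
      (∫ t in (0 : ℝ)..τ, ∫ x in Ω, {y | w t y < v t y}.indicator
        (fun y => f (t, y) - g (t, y)) x)
      + ∫ x in Ω, max (v 0 x - w 0 x) 0 := by
  have hπ : (volume.restrict (Ioo 0 T)).prod (volume.restrict Ω) =
      volume.restrict (spaceTime Ω T) := restrict_prod_eq 0 T Ω
  rw [← hπ] at hM hMell hE
  rw [IntegrableOn, ← hπ] at hf hg
  obtain ⟨Yv, Gv, hrv⟩ := hv.exists_isRepresentative
  obtain ⟨Yw, Gw, hrw⟩ := hw.exists_isRepresentative
  have mYv := hrv.measurable_fn.measurable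
  have mYw := hrw.measurable_fn.measurable
  have hBloc : ∀ a b, 0 < a → a < b → b < T →
      MemLp (fun p => ‖E p‖ * (|Yv p| ^ (θ + 1) + |Yw p| ^ (θ + 1))) 2
        ((volume.restrict (Ioo a b)).prod (volume.restrict Ω)) := by
    intro a b h1 h2 h3
    have hm : Measurable fun p => |Yv p| ^ (θ + 1) + |Yw p| ^ (θ + 1) := by fun_prop
    refine (hloc a b h1 h2 h3).memLp ((hE.1.mono_measure
      (restrict_prod_mono h1.le h3.le Ω)).norm.mul hm.aestronglyMeasurable) ?_
    filter_upwards [ae_restrict_of_ae_restrict_of_subset (Ioo_subset_Ioo h1.le h3.le) hrv.fn_eq,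
      ae_restrict_of_ae_restrict_of_subset (Ioo_subset_Ioo h1.le h3.le) hrw.fn_eq] with t e1 e2
    filter_upwards [e1, e2] with x k1 k2
    rw [k1, k2]
  let B : ℝ × Eu N → ℝ := fun p => (|Yv p| ^ θ + |Yw p| ^ θ) * ‖E p‖
  have hB : MemLp B 2
      ((volume.restrict (Ioo 0 T)).prod (volume.restrict Ω)) := by
    have hm : Measurable fun p => |Yv p| ^ θ + |Yw p| ^ θ := by fun_prop
    refine hglob.memLp (hm.aestronglyMeasurable.mul hE.1.norm) ?_
    filter_upwards [hrv.fn_eq, hrw.fn_eq] with t e1 e2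
    filter_upwards [e1, e2] with x k1 k2
    simp only [B]
    rw [k1, k2]
  have hMb : ∀ᵐ p ∂((volume.restrict (Ioo 0 T)).prod (volume.restrict Ω)), ‖M p‖ ≤ β :=
    hMell.mono fun p hp => hp.2
  have hFv : ∀ a b, 0 < a → a < b → b < T →
      MemLp (flux M E θ Yv Gv) 2 ((volume.restrict (Ioo a b)).prod (volume.restrict Ω)) :=
    fun a b h1 h2 h3 => hrv.memLp_flux hv.memL2loc hθ hM hMb hE.1 h1 h2 h3 (hBloc a b h1 h2 h3)
      fun p => mul_le_mul_of_nonneg_left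
        (le_add_of_nonneg_right (Real.rpow_nonneg (abs_nonneg _) _)) (norm_nonneg _)
  have hFw : ∀ a b, 0 < a → a < b → b < T →
      MemLp (flux M E θ Yw Gw) 2 ((volume.restrict (Ioo a b)).prod (volume.restrict Ω)) :=
    fun a b h1 h2 h3 => hrw.memLp_flux hw.memL2loc hθ hM hMb hE.1 h1 h2 h3 (hBloc a b h1 h2 h3)
      fun p => mul_le_mul_of_nonneg_left
        (le_add_of_nonneg_left (Real.rpow_nonneg (abs_nonneg _) _)) (norm_nonneg _)
  let z : ℝ → Lp ℝ 1 (volume.restrict Ω) := fun t => v t - w t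
  let u : ℝ → W0 Ω := fun t => V t - W t
  let u' : ℝ → WNeg Ω := fun t => V' t - W' t
  let Y : ℝ × Eu N → ℝ := fun p => Yv p - Yw p
  let G : ℝ × Eu N → Eu N := fun p => Gv p - Gw p
  let F : ℝ × Eu N → Eu N := fun p => flux M E θ Yv Gv p - flux M E θ Yw Gw p
  let k : ℝ × Eu N → ℝ := fun p => f p - g p
  have hz : ContinuousOn z (Icc 0 T) := hv.continuousOn.sub hw.continuousOn
  have hzv : ∀ t, ∀ᵐ x ∂(volume.restrict Ω), z t x = v t x - w t x :=
    fun t => Lp.coeFn_sub (v t) (w t)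
  have hY : StronglyMeasurable Y := hrv.measurable_fn.sub hrw.measurable_fn
  have hk : Integrable k ((volume.restrict (Ioo 0 T)).prod (volume.restrict Ω)) := hf.sub hg
  have hu' : MemL2loc T u' := hv.memL2loc_deriv.sub hw.memL2loc_deriv
  have hYz : ∀ᵐ t ∂(volume.restrict (Ioo 0 T)), ∀ᵐ x ∂(volume.restrict Ω), Y (t, x) = z t x := by
    filter_upwards [hrv.fn_eq, hrw.fn_eq] with t e1 e2
    filter_upwards [e1, e2, hzv t] with x k1 k2 k3
    rw [k3, ← k1, ← k2]
  have hzu : ∀ᵐ t ∂(volume.restrict (Ioo 0 T)), ∀ᵐ x ∂(volume.restrict Ω),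
      (u t).fn x = z t x := by
    filter_upwards [hv.ae_eq, hw.ae_eq] with t e1 e2
    filter_upwards [e1, e2, hzv t, Lp.coeFn_sub (V t).fn (W t).fn] with x k1 k2 k3 k4
    rw [k3, ← k1, ← k2, W0.fn_sub, k4, Pi.sub_apply]
  have hGu : ∀ᵐ t ∂(volume.restrict (Ioo 0 T)), ∀ᵐ x ∂(volume.restrict Ω),
      G (t, x) = (u t).grad x := by
    filter_upwards [hrv.grad_eq, hrw.grad_eq] with t e1 e2
    filter_upwards [e1, e2, Lp.coeFn_sub (V t).grad (W t).grad] with x k1 k2 k4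
    rw [W0.grad_sub, k4, Pi.sub_apply, ← k1, ← k2]
  have hF : ∀ a b, 0 < a → a < b → b < T →
      MemLp F 2 ((volume.restrict (Ioo a b)).prod (volume.restrict Ω)) :=
    fun a b h1 h2 h3 => (hFv a b h1 h2 h3).sub (hFw a b h1 h2 h3)
  have hu : MemL2loc T u := hv.memL2loc.sub hw.memL2loc
  have hd : HasWeakTimeDeriv T u u' :=
    HasWeakTimeDeriv.sub hv.memL2loc hw.memL2loc hv.memL2loc_deriv hw.memL2loc_deriv
      hv.hasWeakTimeDeriv hw.hasWeakTimeDeriv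
  have hineq := ae_forall_unitBounded_le hu' hF hk
    (fun ζ hζ t₁ t₂ h1 h12 h2 => sub_weakForm_const_le hT hf hg hrv hrw hv.memL2loc_deriv
      hw.memL2loc_deriv hFv hFw hvsub hwsup hζ h1 h12 h2)
  let P : ℝ → ℝ := fun t => ∫ x in Ω, max (z t x) 0
  have hPeq : ∀ t, ∫ x in Ω, max (v t x - w t x) 0 = P t := fun t => by
    refine integral_congr_ae ?_
    filter_upwards [hzv t] with x hx
    rw [hx]
  have hP : ContinuousOn P (Icc 0 T) :=
    continuousOn_integral_comp (Θ := fun s => max s 0)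
      (fun x y => abs_max_sub_max_le_abs x y 0) (by simp) hz
  let κ : ℝ → ℝ := fun t => ∫ x in Ω, {q | 0 < Y q}.indicator k (t, x)
  have hpos : MeasurableSet {q | 0 < Y q} := measurableSet_lt measurable_const hY.measurable
  have hkpos : Integrable ({q | 0 < Y q}.indicator k)
      ((volume.restrict (Ioo 0 T)).prod (volume.restrict Ω)) := hk.indicator hpos
  have hκ : IntervalIntegrable κ volume 0 T :=
    (intervalIntegrable_iff_integrableOn_Ioo_of_le hT.le).2 hkpos.integral_prod_left
  -- The set {w(t) < v(t)} is defined slice by slice; for almost every t it agrees up to a null set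
  -- with the slice of the jointly measurable {Y > 0}.
  have hκτ : (∫ t in (0 : ℝ)..τ, ∫ x in Ω, {y | w t y < v t y}.indicator
      (fun y => f (t, y) - g (t, y)) x) = ∫ t in (0 : ℝ)..τ, κ t := by
    rw [intervalIntegral.integral_of_le hτ.1, intervalIntegral.integral_of_le hτ.1,
      integral_Ioc_eq_integral_Ioo, integral_Ioc_eq_integral_Ioo]
    refine integral_congr_ae ?_
    filter_upwards [ae_restrict_of_ae_restrict_of_subset (Ioo_subset_Ioo le_rfl hτ.2) hYz]
      with t e1
    refine integral_congr_ae ?_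
    filter_upwards [e1, hzv t] with x k1 k2
    simp only [indicator, mem_ofPred_eq, k1, k2, sub_pos, k]
  have hloc' : ∀ a b, 0 < a → a < b → b < T → P b - P a ≤ ∫ t in a..b, κ t := by
    intro a b ha hab hb
    have hle := restrict_prod_mono ha.le hb.le Ω
    have hfl : ∀ᵐ p ∂((volume.restrict (Ioo a b)).prod (volume.restrict Ω)), ∀ h C : ℝ, 0 ≤ h →
        h * Y p ^ 2 ≤ C → -(C * ((θ + 1) ^ 2 / (4 * α))) * B p ^ 2 ≤ ⟪F p, h • G p⟫_ℝ := by
      filter_upwards [hMell.filter_mono (ae_mono hle)] with p hp h C hh hC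
      exact neg_le_inner_flux hα hp.1 hθ.le (E p) (Gv p) (Gw p) (Yv p) (Yw p) hh hC
    have := integral_posPart_sub_le hΩb hz hzu hu hu' hd hY hYz hGu ha hab hb (hF a b ha hab hb)
      (hk.mono_measure hle) (hB.mono_measure hle) hineq hfl
    rw [integral_prod _ (hkpos.mono_measure hle)] at this
    rwa [intervalIntegral.integral_of_le hab.le, integral_Ioc_eq_integral_Ioo]
  rw [hPeq, hPeq, hκτ]
  exact le_integral_add_of_forall_Ioo hT hP hκ hloc' hτ

theorem ae_le_of_integral_posPart_nonpos {α : Type*} {m : MeasurableSpace α} {μ : Measure α}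
    {v w : Lp ℝ 1 μ} (h : ∫ x, max (v x - w x) 0 ∂μ ≤ 0) : ∀ᵐ x ∂μ, v x ≤ w x := by
  have h0 : 0 ≤ᵐ[μ] fun x => max (v x - w x) 0 := Eventually.of_forall fun x => le_max_right _ _
  have hi : Integrable (fun x => max (v x - w x) 0) μ :=
    ((L1.integrable_coeFn v).sub (L1.integrable_coeFn w)).pos_part
  have := (integral_eq_zero_iff_of_nonneg_ae h0 hi).1 (le_antisymm h (integral_nonneg_of_ae h0))
  filter_upwards [this] with x hx
  have : v x - w x ≤ 0 := (le_max_left _ _).trans hx.le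
  linarith

theorem integral_indicator_sub_eq_zero {f g : ℝ × Eu N → ℝ}
    (hfg : ∀ᵐ p ∂(volume.restrict (spaceTime Ω T)), f p = g p) (S : ℝ → Set (Eu N)) {τ : ℝ}
    (hτ : τ ∈ Icc (0 : ℝ) T) :
    ∫ t in (0 : ℝ)..τ, ∫ x in Ω, (S t).indicator (fun y => f (t, y) - g (t, y)) x = 0 := by
  have hπ : (volume.restrict (Ioo 0 T)).prod (volume.restrict Ω) =
      volume.restrict (spaceTime Ω T) := restrict_prod_eq 0 T Ω
  rw [← hπ] at hfg
  rw [intervalIntegral.integral_of_le hτ.1, integral_Ioc_eq_integral_Ioo]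
  refine integral_eq_zero_of_ae ?_
  filter_upwards [ae_restrict_of_ae_restrict_of_subset (Ioo_subset_Ioo le_rfl hτ.2)
    (Measure.ae_ae_of_ae_prod hfg)] with t ht
  refine integral_eq_zero_of_ae ?_
  filter_upwards [ht] with x hx
  simp [indicator, hx]

end DriftParabolic

end ContractionLemmas

theorem theorem3p2 {N : ℕ} (hN : 3 ≤ N) {Ω : Set (Eu N)} (hΩo : IsOpen Ω)
    (hΩb : Bornology.IsBounded Ω) {T : ℝ} (hT : 0 < T)
    -- the bounded elliptic matrix field
    (M : ℝ × Eu N → (Eu N →L[ℝ] Eu N)) {α β : ℝ} (hα : 0 < α) (hαβ : α ≤ β)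
    (hM : AEStronglyMeasurable M (volume.restrict (spaceTime Ω T)))
    (hMell : ∀ᵐ p ∂(volume.restrict (spaceTime Ω T)),
      (∀ ξ : Eu N, α * ‖ξ‖ ^ 2 ≤ ⟪M p ξ, ξ⟫_ℝ) ∧ ‖M p‖ ≤ β)
    {θ : ℝ} (hθ : 0 < θ)
    {f g : ℝ × Eu N → ℝ} (hf : IntegrableOn f (spaceTime Ω T))
    (hg : IntegrableOn g (spaceTime Ω T))
    {E : ℝ × Eu N → Eu N} (hE : MemLp E 2 (volume.restrict (spaceTime Ω T)))
    {v w : ℝ → Lp ℝ 1 (volume.restrict Ω)} {V W : ℝ → W0 Ω} {V' W' : ℝ → WNeg Ω}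
    (hv : MemCL1W2loc T v V V') (hw : MemCL1W2loc T w W W')
    -- `|E| (|v|^{θ+1} + |w|^{θ+1}) ∈ L²_loc((0,T); L²(Ω))`
    (hloc : ∀ a b : ℝ, 0 < a → a < b → b < T →
      FiniteL2 Ω a b (fun t x => ‖E (t, x)‖ * (|v t x| ^ (θ + 1) + |w t x| ^ (θ + 1))))
    (hvsub : IsSubsolution T M E θ f v V V') (hwsup : IsSupersolution T M E θ g w W W')
    -- `(|v|^θ + |w|^θ) |E| ∈ L²(Ω_T)`
    (hglob : FiniteL2 Ω 0 T (fun t x => (|v t x| ^ θ + |w t x| ^ θ) * ‖E (t, x)‖)) :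
    -- the `L¹` contraction
    (∀ τ ∈ Icc (0 : ℝ) T,
      ∫ x in Ω, max (v τ x - w τ x) 0 ≤
        (∫ t in (0 : ℝ)..τ, ∫ x in Ω, {y | w t y < v t y}.indicator
          (fun y => f (t, y) - g (t, y)) x)
        + ∫ x in Ω, max (v 0 x - w 0 x) 0) ∧
    -- uniqueness: weak solutions with the same source and the same initial datum coincide
    (IsSupersolution T M E θ f v V V' → IsSubsolution T M E θ g w W W' →
      (∀ᵐ p ∂(volume.restrict (spaceTime Ω T)), f p = g p) → v 0 = w 0 →
      ∀ τ ∈ Icc (0 : ℝ) T, v τ = w τ) := by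
  have h1 : ∀ τ ∈ Icc (0 : ℝ) T, _ := fun τ hτ => integral_posPart_le hΩb hT hα hM hMell hθ hf hg
    hE hv hw hloc hvsub hwsup hglob hτ
  refine ⟨h1, fun hvsup hwsub hfg h0 τ hτ => ?_⟩
  -- The reverse comparison: w is now the subsolution and v the supersolution.
  have h2 := integral_posPart_le hΩb hT hα hM hMell hθ hg hf hE hw hv
    (by simpa only [add_comm] using hloc) hwsub hvsup (by simpa only [add_comm] using hglob) hτ
  have h1 := h1 τ hτ
  rw [integral_indicator_sub_eq_zero hfg _ hτ, h0] at h1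
  rw [integral_indicator_sub_eq_zero (hfg.mono fun p hp => hp.symm) _ hτ, h0] at h2
  simp only [sub_self, max_self, integral_zero, add_zero] at h1 h2
  refine Lp.ext ?_
  filter_upwards [ae_le_of_integral_posPart_nonpos h1, ae_le_of_integral_posPart_nonpos h2]
    with x k1 k2 using le_antisymm k1 k2
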